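/- Let $d\in\mathbb N$, $T>0$, $u_0\in L^\infty(\mathbb R^d)$, and let $f:[0,T]\times\mathbb R^d\times\mathbb R\to\mathbb R^d$, $F:[0,T]\times\mathbb R^d\times\mathbb R\to\mathbb R$. Consider $$\text{(B.1)}\qquad \partial_t u+\operatorname{Div} f(t,x,u)=F(t,x,u)\ \text{ on }[0,T]\times\mathbb R^d,\qquad u(0,x)=u_0(x)\ \text{ on }\mathbb R^d,$$ where $\operatorname{Div}$ is the total divergence of $x\mapsto f(t,x,u(t,x))$. Below, $\nabla$ and $\operatorname{div}$ are taken in the variable $x$ only, with $t$ and $u$ fixed. *Weak entropy solution.* $u\in L^\infty([0,T]\times\mathbb R^d)$ is a weak entropy solution of (B.1) if (i) for all $k\in\mathbb R$ and all $\varphi\in C_c^\infty((0,T)\times\mathbb R^d)$ with $\varphi\ge0$, $$\int_0^T\!\!\int_{\mathbb R^d}|u-k|\,\partial_t\varphi+\operatorname{sgn}(u-k)\,(f(t,x,u)-f(t,x,k))\cdot\nabla\varphi+\operatorname{sgn}(u-k)\,(F(t,x,u)-\operatorname{div}f(t,x,k))\,\varphi\;dx\,dt\ \ge 0,$$ (ii)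 there is a null set $\mathcal E\subseteq[0,T]$ such that for $t\in[0,T]\setminus\mathcal E$ the function $u(t,\cdot)$ is a measurable function defined a.e., and $\lim_{t\downarrow0,\,t\notin\mathcal E}\int_{B_r(0)}|u(t,x)-u_0(x)|\,dx=0$ for all $r>0$. *Hypotheses.* (H1) $f,F$ are continuous; $\partial_uf,\ \partial_u\nabla f,\ \nabla^2f,\ \partial_uF,\ \nabla F$ exist and are continuous; and $\partial_uf,\ F-\operatorname{div}f,\ \partial_u(F-\operatorname{div}f)\in L^\infty([0,T]\times\mathbb R^d\times[-U,U])$ for all $U>0$. (H2) For all $U>0$: $\nabla\partial_uf,\ \partial_uF\in L^\infty([0,T]\times\mathbb R^d\times[-U,U])$ and $\int_0^T\int_{\mathbb R^d}\|\nabla(F-\operatorname{div}f)(t,x,\cdot)\|_{L^\infty([-U,U])}\,dx\,dt<\infty$. (H2*) For all $U,R>0$: $\nabla\partial_uf,\ \partial_uF\in L^\infty([0,T]\times\mathbb R^d\times[-U,U])$ and $\int_0^T\int_{B_R(0)}\|\nabla(F-\operatorname{div}f)(t,x,\cdot)\|_{L^\infty([-U,U])}\,dx\,dt<\infty$. **Corollary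 B.4 (uniqueness of weak entropy solutions).** Assume that $f,F$ satisfy (H1) and (H2*). Let $u$ be a weak entropy solution of (B.1), and suppose that for every $\varepsilon>0$ there are $f^\varepsilon,F^\varepsilon$ satisfying (H1) and (H2), $u_0^\varepsilon\in L^\infty(\mathbb R^d)$, and a weak entropy solution $u^\varepsilon$ of $$\partial_tu^\varepsilon+\operatorname{Div}f^\varepsilon(t,x,u^\varepsilon)=F^\varepsilon(t,x,u^\varepsilon),\qquad u^\varepsilon(0,x)=u^\varepsilon_0(x),$$ such that $\sup_{\varepsilon>0}\|u^\varepsilon\|_{L^\infty([0,T]\times\mathbb R^d)}<\infty$, $u^\varepsilon\to u$ in $L^1([0,T];L^1_{loc}(\mathbb R^d))$ as $\varepsilon\to0$, and for every $R>0$ there is an $\varepsilon>0$ such that $$f^\varepsilon=f,\quad F^\varepsilon=F\quad\text{on }[0,T]\times B_R(0)\times\mathbb R,\qquad u_0^\varepsilon=u_0\quad\text{a.e. on }B_R(0).$$ Then $u$ is the unique weak entropy solution of (B.1): every weak entropy solution $v$ of (B.1) satisfies $v=u$ a.e. on $[0,T]\times\mathbb R^d$. If moreover $t\mapsto u(t)$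 and $t\mapsto v(t)$ are right-continuous from $[0,T]$ into $L^1_{loc}(\mathbb R^d)$, then $v(t)=u(t)$ a.e. on $\mathbb R^d$ for every $t\in[0,T)$. -/

import Mathlib

open Set Filter Topology MeasureTheory
open scoped ContDiff ENNReal

noncomputable section

namespace ConservationLaw

/-- The space `ℝᵈ` with its Euclidean norm. -/
abbrev Space (d : ℕ) : Type := EuclideanSpace ℝ (Fin d)

/-- The partial gradient `∇f(t,x,u)` (derivative in the space variable `x` only) of a function of
`(t,x,u)`, as a linear map on `ℝᵈ`. -/
def gradX {d : ℕ} {V : Type*} [NormedAddCommGroup V] [NormedSpace ℝ V]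
    (h : ℝ → Space d → ℝ → V) (t : ℝ) (x : Space d) (u : ℝ) : Space d →L[ℝ] V :=
  fderiv ℝ (fun y => h t y u) x

/-- The partial derivative `∂ᵤf(t,x,u)` of a function of `(t,x,u)`. -/
def derivU {d : ℕ} {V : Type*} [NormedAddCommGroup V] [NormedSpace ℝ V]
    (h : ℝ → Space d → ℝ → V) (t : ℝ) (x : Space d) (u : ℝ) : V :=
  deriv (fun w => h t x w) u

/-- The partial divergence `div f(t,x,u) = ∑ₖ ∂_{xₖ} fᵏ(t,x,u)`, taken in `x` with `t`, `u` fixed. -/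
def divX {d : ℕ} (f : ℝ → Space d → ℝ → Space d) (t : ℝ) (x : Space d) (u : ℝ) : ℝ :=
  ∑ k : Fin d, (gradX f t x u (EuclideanSpace.single k 1)) k

/-- The function `F - div f`. -/
def excess {d : ℕ} (f : ℝ → Space d → ℝ → Space d) (F : ℝ → Space d → ℝ → ℝ)
    (t : ℝ) (x : Space d) (u : ℝ) : ℝ :=
  F t x u - divX f t x u

/-- `h` is continuous on `[0,T] × ℝᵈ × ℝ`. -/
def ContinuousOnSlab {d : ℕ} {V : Type*} [TopologicalSpace V] (T : ℝ)
    (h : ℝ → Space d → ℝ → V) : Prop :=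
  ContinuousOn (fun p : ℝ × Space d × ℝ => h p.1 p.2.1 p.2.2) (Icc 0 T ×ˢ univ)

/-- `h ∈ L^∞([0,T] × ℝᵈ × [-U,U])` for every `U > 0`. It is applied only to functions which are
continuous, for which the essential supremum is the supremum. -/
def BoundedOnSlab {d : ℕ} {V : Type*} [NormedAddCommGroup V] (T : ℝ)
    (h : ℝ → Space d → ℝ → V) : Prop :=
  ∀ U : ℝ, 0 < U → ∃ C : ℝ, ∀ t ∈ Icc (0 : ℝ) T, ∀ x : Space d, ∀ u ∈ Icc (-U) U, ‖h t x u‖ ≤ C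

/-- Condition (H1) on `[0,T]`: `f`, `F` are continuous, `∂ᵤf`, `∂ᵤ∇f`, `∇²f`, `∂ᵤF`, `∇F` exist and
are continuous, and `∂ᵤf`, `F - div f`, `∂ᵤ(F - div f)` are bounded on `[0,T] × ℝᵈ × [-U,U]`
for all `U > 0`. (Continuity of `∇f`, listed as `cont_gradX_f`, follows from continuity of `f`
and of `∇²f`.) -/
structure H1 {d : ℕ} (T : ℝ) (f : ℝ → Space d → ℝ → Space d) (F : ℝ → Space d → ℝ → ℝ) :
    Prop where
  cont_f : ContinuousOnSlab T f
  cont_F : ContinuousOnSlab T F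
  diff_u_f : ∀ t ∈ Icc (0 : ℝ) T, ∀ x u, DifferentiableAt ℝ (fun w => f t x w) u
  cont_derivU_f : ContinuousOnSlab T (derivU f)
  diff_x_f : ∀ t ∈ Icc (0 : ℝ) T, ∀ x u, DifferentiableAt ℝ (fun y => f t y u) x
  cont_gradX_f : ContinuousOnSlab T (gradX f)
  diff_u_gradX_f : ∀ t ∈ Icc (0 : ℝ) T, ∀ x u, DifferentiableAt ℝ (fun w => gradX f t x w) u
  cont_derivU_gradX_f : ContinuousOnSlab T (derivU (gradX f))
  diff_x_gradX_f : ∀ t ∈ Icc (0 : ℝ) T, ∀ x u, DifferentiableAt ℝ (fun y => gradX f t y u) x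
  cont_gradX_gradX_f : ContinuousOnSlab T (gradX (gradX f))
  diff_u_F : ∀ t ∈ Icc (0 : ℝ) T, ∀ x u, DifferentiableAt ℝ (fun w => F t x w) u
  cont_derivU_F : ContinuousOnSlab T (derivU F)
  diff_x_F : ∀ t ∈ Icc (0 : ℝ) T, ∀ x u, DifferentiableAt ℝ (fun y => F t y u) x
  cont_gradX_F : ContinuousOnSlab T (gradX F)
  bdd_derivU_f : BoundedOnSlab T (derivU f)
  bdd_excess : BoundedOnSlab T (excess f F)
  bdd_derivU_excess : BoundedOnSlab T (derivU (excess f F))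

/-- `∫₀ᵀ ∫_A ‖∇(F - div f)(t,x,·)‖_{L^∞([-U,U])} dx dt`, as an extended nonnegative real. -/
def excessGradIntegral {d : ℕ} (T : ℝ) (f : ℝ → Space d → ℝ → Space d)
    (F : ℝ → Space d → ℝ → ℝ) (A : Set (Space d)) (U : ℝ) : ℝ≥0∞ :=
  ∫⁻ t in Icc (0 : ℝ) T, ∫⁻ x in A, ⨆ u ∈ Icc (-U) U, ‖gradX (excess f F) t x u‖ₑ

/-- Condition (H2) on `[0,T]`. -/
structure H2 {d : ℕ} (T : ℝ) (f : ℝ → Space d → ℝ → Space d) (F : ℝ → Space d → ℝ → ℝ) :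
    Prop where
  bdd_gradX_derivU_f : BoundedOnSlab T (gradX (derivU f))
  bdd_derivU_F : BoundedOnSlab T (derivU F)
  integral_lt_top : ∀ U : ℝ, 0 < U → excessGradIntegral T f F univ U < ⊤

/-- Condition (H2*) on `[0,T]`, the localized version of (H2). -/
structure H2Star {d : ℕ} (T : ℝ) (f : ℝ → Space d → ℝ → Space d) (F : ℝ → Space d → ℝ → ℝ) :
    Prop where
  bdd_gradX_derivU_f : BoundedOnSlab T (gradX (derivU f))
  bdd_derivU_F : BoundedOnSlab T (derivU F)
  integral_lt_top : ∀ U R : ℝ, 0 < U → 0 < R →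
    excessGradIntegral T f F (Metric.ball 0 R) U < ⊤

/-- Lebesgue measure on `[0,T] × ℝᵈ`. -/
def slab (d : ℕ) (T : ℝ) : Measure (ℝ × Space d) :=
  volume.restrict (Icc (0 : ℝ) T ×ˢ univ)

/-- The integrand of the entropy inequality for the constant `k` and the test function `φ`;
`fderiv ℝ φ (t,x) (1,0) = ∂ₜφ(t,x)` and `fderiv ℝ φ (t,x) (0,w) = w · ∇φ(t,x)`. -/
def entropyIntegrand {d : ℕ} (f : ℝ → Space d → ℝ → Space d) (F : ℝ → Space d → ℝ → ℝ)
    (u : ℝ → Space d → ℝ) (k : ℝ) (φ : ℝ × Space d → ℝ) (t : ℝ) (x : Space d) : ℝ :=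
  |u t x - k| * fderiv ℝ φ (t, x) (1, 0)
    + Real.sign (u t x - k) * fderiv ℝ φ (t, x) (0, f t x (u t x) - f t x k)
    + Real.sign (u t x - k) * (F t x (u t x) - divX f t x k) * φ (t, x)

/-- `u ∈ L^∞([0,T] × ℝᵈ)` is a weak entropy solution of `∂ₜu + Div f(t,x,u) = F(t,x,u)`,
`u(0) = u₀`. The function `u` is a representative of its class; the notion does not depend on the
representative, because the exceptional null set of times in `initial` may be enlarged. -/
structure IsWeakEntropySolution {d : ℕ} (T : ℝ) (f : ℝ → Space d → ℝ → Space d)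
    (F : ℝ → Space d → ℝ → ℝ) (u₀ : Space d → ℝ) (u : ℝ → Space d → ℝ) : Prop where
  memLp : MemLp (fun p : ℝ × Space d => u p.1 p.2) ⊤ (slab d T)
  entropy : ∀ k : ℝ, ∀ φ : ℝ × Space d → ℝ, ContDiff ℝ ∞ φ → HasCompactSupport φ →
    tsupport φ ⊆ Ioo (0 : ℝ) T ×ˢ univ → (∀ p, 0 ≤ φ p) →
    0 ≤ ∫ p, entropyIntegrand f F u k φ p.1 p.2 ∂(slab d T)
  initial : ∃ N : Set ℝ, N ⊆ Icc 0 T ∧ volume N = 0 ∧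
    (∀ t ∈ Icc (0 : ℝ) T \ N, AEStronglyMeasurable (u t) volume) ∧
    ∀ r : ℝ, 0 < r →
      Tendsto (fun t => ∫⁻ x in Metric.ball (0 : Space d) r, ‖u t x - u₀ x‖ₑ)
        (𝓝[Ioc 0 T \ N] 0) (𝓝 0)

/-- `t ↦ u(t)` is right-continuous from `[0,T]` into `L¹_loc(ℝᵈ)`. -/
def RightContinuousL1loc {d : ℕ} (T : ℝ) (u : ℝ → Space d → ℝ) : Prop :=
  (∀ t ∈ Icc (0 : ℝ) T, LocallyIntegrable (u t) volume) ∧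
  ∀ t ∈ Icc (0 : ℝ) T, ∀ r : ℝ, 0 < r →
    Tendsto (fun s => ∫⁻ x in Metric.ball (0 : Space d) r, ‖u s x - u t x‖ₑ)
      (𝓝[Ioc t T] t) (𝓝 0)

/-- `u^ε → u` in `L¹([0,T]; L¹_loc(ℝᵈ))` as `ε → 0`, `ε > 0`. -/
def TendstoL1L1loc {d : ℕ} (T : ℝ) (uε : ℝ → ℝ → Space d → ℝ) (u : ℝ → Space d → ℝ) : Prop :=
  ∀ r : ℝ, 0 < r →
    Tendsto (fun ε => ∫⁻ p in Icc (0 : ℝ) T ×ˢ Metric.ball (0 : Space d) r,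
      ‖uε ε p.1 p.2 - u p.1 p.2‖ₑ) (𝓝[>] 0) (𝓝 0)

end ConservationLaw

end

/-!
Kružkov's doubling of variables, localized in a cone of dependence. The entropy inequality for `u`
with the constant `v q`, and for `v` with the constant `u p`, are integrated against test functions
concentrated near the diagonal `p = q`. As the coefficients are only continuous in time, the
concentration is anisotropic: the time scale tends to zero first, for a fixed spatial scale `h`,
and only then `h → 0`. This yields the Kato inequality
`∂ₜ|u - v| + div (sgn (u - v) (f (u) - f (v))) ≤ sgn (u - v) (F (u) - F (v))`. Testing it with a
weight that decays exponentially in time and is supported in a backward cone whose slope bounds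
`|∂ᵤf|`, the weighted mass of `|u - v|` is nonincreasing; it vanishes at time zero because `u` and
`v` have the same initial datum, so it vanishes identically.
-/

namespace ConservationLaw

section Translation

variable {E V : Type*} [NormedAddCommGroup E] [MeasurableSpace E] [BorelSpace E]
  [NormedAddCommGroup V] (μ : Measure E) [μ.IsAddHaarMeasure]

theorem integral_comp_continuousLinearEquiv [NormedSpace ℝ E] [FiniteDimensional ℝ E]
    [NormedSpace ℝ V] (L : E ≃L[ℝ] E) (G : E → V) :
    ∫ x, G (L x) ∂μ = |(LinearMap.det (L.toLinearEquiv : E →ₗ[ℝ] E))⁻¹| • ∫ x, G x ∂μ := by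
  have hdet := (LinearEquiv.isUnit_det' L.toLinearEquiv).ne_zero
  calc ∫ x, G (L x) ∂μ = ∫ x, G x ∂(μ.map (L.toLinearEquiv : E →ₗ[ℝ] E)) :=
        (L.toHomeomorph.measurableEmbedding.integral_map G).symm
    _ = _ := by
        rw [Measure.map_linearMap_addHaar_eq_smul_addHaar μ hdet, integral_smul_measure,
          ENNReal.toReal_ofReal (abs_nonneg _)]

theorem tendsto_lintegral_translate [ProperSpace E] {w : E → V} (hw : Integrable w μ)
    {ι : Type*} {l : Filter ι} {a : ι → E} (ha : Tendsto a l (𝓝 0)) :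
    Tendsto (fun i => ∫⁻ x, ‖w (x - a i) - w x‖ₑ ∂μ) l (𝓝 0) := by
  let G : C(E, C(E, E)) := (ContinuousMap.mk (fun z : E × E => z.2 - z.1) (by fun_prop)).curry
  have hG : ∀ b, MeasurePreserving (G b) μ μ := measurePreserving_sub_right μ
  have hw' : MemLp w 1 μ := memLp_one_iff_integrable.2 hw
  have key := Filter.Tendsto.compMeasurePreservingLp (f := fun _ => hw'.toLp w)
    (g := fun i => G (a i)) tendsto_const_nhds ((G.continuous.tendsto 0).comp ha)
    (fun i => hG (a i)) (hG 0) ENNReal.one_ne_top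
  rw [tendsto_iff_edist_tendsto_0] at key
  refine key.congr fun i => ?_
  rw [Lp.edist_def, eLpNorm_one_eq_lintegral_enorm]
  refine lintegral_congr_ae ?_
  filter_upwards [Lp.coeFn_compMeasurePreserving (hw'.toLp w) (hG (a i)),
    Lp.coeFn_compMeasurePreserving (hw'.toLp w) (hG 0),
    (hG (a i)).quasiMeasurePreserving.ae_eq_comp hw'.coeFn_toLp,
    (hG 0).quasiMeasurePreserving.ae_eq_comp hw'.coeFn_toLp] with x h₁ h₂ h₃ h₄
  rw [Pi.sub_apply, h₁, h₂, h₃, h₄]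
  simp [G]

variable {Z : Type*} [MeasurableSpace Z] (ν : Measure Z) [IsFiniteMeasure ν]

theorem tendsto_lintegral_prod_translate [ProperSpace E] {w : E → V}
    (hw : StronglyMeasurable w) (hwi : Integrable w μ) {S : ℕ → Z → E}
    (hSm : ∀ n, Measurable (S n)) (hS : ∀ ζ, Tendsto (fun n => S n ζ) atTop (𝓝 0)) :
    Tendsto (fun n => ∫⁻ z, ‖w (z.1 - S n z.2) - w z.1‖ₑ ∂(μ.prod ν)) atTop (𝓝 0) := by
  have hmeas (n : ℕ) : Measurable fun z : E × Z => ‖w (z.1 - S n z.2) - w z.1‖ₑ :=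
    ((hw.comp_measurable (measurable_fst.sub ((hSm n).comp measurable_snd))).sub
      (hw.comp_measurable measurable_fst)).enorm
  have hbound (a : E) : ∫⁻ x, ‖w (x - a) - w x‖ₑ ∂μ ≤ 2 * ∫⁻ x, ‖w x‖ₑ ∂μ :=
    calc ∫⁻ x, ‖w (x - a) - w x‖ₑ ∂μ ≤ ∫⁻ x, ‖w (x - a)‖ₑ + ‖w x‖ₑ ∂μ :=
          lintegral_mono fun x => enorm_sub_le
      _ = 2 * ∫⁻ x, ‖w x‖ₑ ∂μ := by
          rw [lintegral_add_right _ hw.enorm, lintegral_sub_right_eq_self (fun x => ‖w x‖ₑ),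
            two_mul]
  simp_rw [lintegral_prod_symm' _ (hmeas _)]
  rw [← lintegral_zero (μ := ν)]
  refine tendsto_lintegral_of_dominated_convergence (fun _ => 2 * ∫⁻ x, ‖w x‖ₑ ∂μ)
    (fun n => (hmeas n).lintegral_prod_left') (fun n => .of_forall fun ζ => hbound _) ?_
    (.of_forall fun ζ => tendsto_lintegral_translate μ hwi (hS ζ))
  rw [lintegral_const]
  exact ENNReal.mul_ne_top (ENNReal.mul_ne_top ENNReal.ofNat_ne_top hwi.2.ne)
    (measure_ne_top ν univ)

theorem exists_subseq_ae_tendsto_translate [ProperSpace E] {v : E → V}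
    (hv : StronglyMeasurable v) (hvi : LocallyIntegrable v μ) {K : Set E} (hK : IsCompact K)
    {S : ℕ → Z → E} (hSm : ∀ n, Measurable (S n))
    (hS : ∀ ζ, Tendsto (fun n => S n ζ) atTop (𝓝 0)) :
    ∃ φ : ℕ → ℕ, StrictMono φ ∧ ∀ᵐ z ∂(μ.prod ν), z.1 ∈ K →
      Tendsto (fun n => v (z.1 - S (φ n) z.2)) atTop (𝓝 (v z.1)) := by
  set B := Metric.cthickening 1 K
  have hB : IsCompact B := hK.cthickening
  set w : E → V := B.indicator v
  have hw : StronglyMeasurable w := hv.indicator hB.measurableSet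
  have hwi : Integrable w μ :=
    (integrable_indicator_iff hB.measurableSet).2 (hvi.integrableOn_isCompact hB)
  have hlim : TendstoInMeasure (μ.prod ν) (fun n z => w (z.1 - S n z.2) - w z.1) atTop 0 := by
    refine tendstoInMeasure_of_tendsto_eLpNorm one_ne_zero (fun n => ?_)
      aestronglyMeasurable_zero ?_
    · exact ((hw.comp_measurable (measurable_fst.sub ((hSm n).comp measurable_snd))).sub
        (hw.comp_measurable measurable_fst)).aestronglyMeasurable
    · simpa only [eLpNorm_one_eq_lintegral_enorm, sub_zero] using
        tendsto_lintegral_prod_translate μ ν hw hwi hSm hS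
  obtain ⟨φ, hφ, hae⟩ := hlim.exists_seq_tendsto_ae
  refine ⟨φ, hφ, ?_⟩
  filter_upwards [hae] with z hz hzK
  have hwv : Tendsto (fun n => w (z.1 - S (φ n) z.2)) atTop (𝓝 (w z.1)) := by
    simpa using hz.add_const (w z.1)
  have hnhds : B ∈ 𝓝 z.1 := mem_of_superset
    (Metric.isOpen_thickening.mem_nhds (Metric.self_subset_thickening one_pos K hzK))
    (Metric.thickening_subset_cthickening 1 K)
  have hmem : ∀ᶠ n in atTop, z.1 - S (φ n) z.2 ∈ B := by
    have := ((hS z.2).comp hφ.tendsto_atTop).const_sub z.1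
    rw [sub_zero] at this
    exact this.eventually_mem hnhds
  rw [show w z.1 = v z.1 from indicator_of_mem (mem_of_mem_nhds hnhds) v] at hwv
  exact hwv.congr' (hmem.mono fun n hn => indicator_of_mem hn v)

end Translation

section Sign

theorem abs_sign_le_one (r : ℝ) : |Real.sign r| ≤ 1 := by
  rcases Real.sign_apply_eq r with h | h | h <;> simp [h]

theorem sign_mul_self_eq_abs (r : ℝ) : Real.sign r * r = |r| := by
  rcases lt_trichotomy r 0 with h | rfl | h
  · rw [Real.sign_of_neg h, abs_of_neg h, neg_one_mul]
  · simp
  · rw [Real.sign_of_pos h, abs_of_pos h, one_mul]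

theorem abs_sign_mul_le (r y : ℝ) : |Real.sign r * y| ≤ |y| := by
  rw [abs_mul]
  exact mul_le_of_le_one_left (abs_nonneg y) (abs_sign_le_one r)

theorem measurable_sign : Measurable Real.sign :=
  Measurable.ite measurableSet_Iio measurable_const
    (Measurable.ite measurableSet_Ioi measurable_const measurable_const)

/-- The jump of the sign at `0` is harmless against a factor vanishing there. -/
theorem tendsto_sign_mul {ι : Type*} {l : Filter ι} {s y : ι → ℝ} {s₀ y₀ : ℝ}
    (hs : Tendsto s l (𝓝 s₀)) (hy : Tendsto y l (𝓝 y₀)) (h : s₀ = 0 → y₀ = 0) :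
    Tendsto (fun i => Real.sign (s i) * y i) l (𝓝 (Real.sign s₀ * y₀)) := by
  rcases lt_trichotomy s₀ 0 with h₀ | h₀ | h₀
  · refine (tendsto_const_nhds.congr' ?_).mul hy
    filter_upwards [hs.eventually_lt_const h₀] with i hi
    rw [Real.sign_of_neg h₀, Real.sign_of_neg hi]
  · rw [h h₀, mul_zero]
    rw [h h₀] at hy
    exact squeeze_zero_norm (fun i => abs_sign_mul_le _ _) (by simpa using hy.abs)
  · refine (tendsto_const_nhds.congr' ?_).mul hy
    filter_upwards [hs.eventually_const_lt h₀] with i hi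
    rw [Real.sign_of_pos h₀, Real.sign_of_pos hi]

variable {X : Type*} [TopologicalSpace X] [MeasurableSpace X] [BorelSpace X]
  {G : X → ℝ → ℝ → ℝ} {u v : X → ℝ}

theorem measurable_sign_mul (hG : Continuous fun z : X × ℝ × ℝ => G z.1 z.2.1 z.2.2)
    (hu : Measurable u) (hv : Measurable v) :
    Measurable fun x => Real.sign (u x - v x) * G x (u x) (v x) :=
  (measurable_sign.comp (hu.sub hv)).mul
    (hG.measurable.comp (measurable_id.prodMk (hu.prodMk hv)))

theorem integrable_sign_mul [SecondCountableTopology X] [T2Space X] (μ : Measure X)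
    [IsFiniteMeasureOnCompacts μ]
    (hG : Continuous fun z : X × ℝ × ℝ => G z.1 z.2.1 z.2.2)
    {K : Set X} (hK : IsCompact K) (hGK : ∀ x, x ∉ K → ∀ a b, G x a b = 0)
    (hu : Measurable u) (hv : Measurable v) {C : ℝ}
    (huC : ∀ x, |u x| ≤ C) (hvC : ∀ x, |v x| ≤ C) :
    Integrable (fun x => Real.sign (u x - v x) * G x (u x) (v x)) μ := by
  obtain ⟨M, hM⟩ := ((hK.prod ((isCompact_Icc (a := -C) (b := C)).prod
    (isCompact_Icc (a := -C) (b := C)))).bddAbove_image hG.abs.continuousOn)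
  have hsupp : (Function.support fun x => Real.sign (u x - v x) * G x (u x) (v x)) ⊆ K :=
    Function.support_subset_iff'.2 fun x hx => by rw [hGK x hx, mul_zero]
  rw [← integrableOn_iff_integrable_of_support_subset hsupp]
  refine Measure.integrableOn_of_bounded (M := M) hK.measure_lt_top.ne
    (measurable_sign_mul hG hu hv).aestronglyMeasurable ?_
  filter_upwards [ae_restrict_mem hK.measurableSet] with x hx
  exact (abs_sign_mul_le _ _).trans
    (hM ⟨(x, u x, v x), ⟨hx, abs_le.1 (huC x), abs_le.1 (hvC x)⟩, rfl⟩)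

end Sign

section Trace

variable {E : Type*} [NormedAddCommGroup E] [NormedSpace ℝ E] [FiniteDimensional ℝ E]

variable (E) in
/-- The trace of an endomorphism, as a continuous linear functional; the divergence of a vector
field is the trace of its derivative. -/
noncomputable def traceCLM : (E →L[ℝ] E) →L[ℝ] ℝ :=
  LinearMap.toContinuousLinearMap (LinearMap.trace ℝ E ∘ₗ ContinuousLinearMap.coeLM ℝ)

theorem traceCLM_eq_sum {ι : Type*} [Fintype ι] (b : Module.Basis ι ℝ E) (A : E →L[ℝ] E) :
    traceCLM E A = ∑ i, b.coord i (A (b i)) := by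
  classical
  change LinearMap.trace ℝ E (A : E →ₗ[ℝ] E) = _
  simp [LinearMap.trace_eq_matrix_trace ℝ b, Matrix.trace, LinearMap.toMatrix_apply]

theorem traceCLM_zero_prodMap (A : E →L[ℝ] E) :
    traceCLM (ℝ × E) ((0 : ℝ →L[ℝ] ℝ).prodMap A) = traceCLM E A := by
  change LinearMap.trace ℝ (ℝ × E) ((0 : ℝ →ₗ[ℝ] ℝ).prodMap (A : E →ₗ[ℝ] E)) = _
  rw [LinearMap.trace_prodMap', map_zero, zero_add]
  rfl

theorem integral_fderiv_linear_field [MeasurableSpace E] [BorelSpace E] (μ : Measure E)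
    [μ.IsAddHaarMeasure] {κ : E → ℝ} (hκ : ContDiff ℝ 1 κ) (hc : HasCompactSupport κ)
    (A : E →L[ℝ] E) : ∫ x, fderiv ℝ κ x (A x) ∂μ = -(traceCLM E A * ∫ x, κ x ∂μ) := by
  let b := Module.finBasis ℝ E
  let c i : E →L[ℝ] ℝ := (b.coord i).toContinuousLinearMap
  have hexp (x : E) : fderiv ℝ κ x (A x) = ∑ i, c i x * fderiv ℝ κ x (A (b i)) :=
    calc fderiv ℝ κ x (A x) = fderiv ℝ κ x (A (∑ i, b.repr x i • b i)) := by rw [b.sum_repr]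
      _ = _ := by simp only [map_sum, map_smul, smul_eq_mul]; rfl
  have hκ' : Continuous (fderiv ℝ κ) := hκ.continuous_fderiv one_ne_zero
  have hi i : Integrable (fun x => c i x * fderiv ℝ κ x (A (b i))) μ := by
    refine Continuous.integrable_of_hasCompactSupport
      ((c i).continuous.mul (hκ'.clm_apply continuous_const)) (HasCompactSupport.mul_left ?_)
    exact (hc.fderiv ℝ).comp_left (g := fun ℓ : E →L[ℝ] ℝ => ℓ (A (b i))) rfl
  have hparts i : ∫ x, c i x * fderiv ℝ κ x (A (b i)) ∂μ = -(c i (A (b i)) * ∫ x, κ x ∂μ) := by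
    have hκc := hκ.continuous
    rw [integral_mul_fderiv_eq_neg_fderiv_mul_of_integrable]
    · simp only [ContinuousLinearMap.fderiv, integral_const_mul]
    · simp only [ContinuousLinearMap.fderiv]
      exact (hκc.integrable_of_hasCompactSupport hc).const_mul _
    · exact hi i
    · exact ((c i).continuous.mul hκc).integrable_of_hasCompactSupport hc.mul_left
    · exact fun x _ => (c i).differentiableAt
    · exact fun x _ => hκ.differentiable one_ne_zero x
  simp_rw [hexp, integral_finsetSum _ fun i _ => hi i, hparts, traceCLM_eq_sum b, Finset.sum_mul,
    Finset.sum_neg_distrib]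
  rfl

end Trace

section TestFunction

variable {X Y : Type*} [NormedAddCommGroup X] [NormedSpace ℝ X] [NormedAddCommGroup Y]
  [NormedSpace ℝ Y]

/-- Nonnegative test functions on `Ω`, the class for which entropy inequalities are required. -/
structure IsTestFunction (Ω : Set X) (φ : X → ℝ) : Prop where
  contDiff : ContDiff ℝ ∞ φ
  hasCompactSupport : HasCompactSupport φ
  tsupport_subset : tsupport φ ⊆ Ω
  nonneg : ∀ x, 0 ≤ φ x

namespace IsTestFunction

variable {Ω : Set X} {φ ψ : X → ℝ} {Ω' : Set Y} {κ : Y → ℝ}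

theorem differentiable (hφ : IsTestFunction Ω φ) : Differentiable ℝ φ :=
  hφ.contDiff.differentiable (by simp)

theorem continuous_fderiv (hφ : IsTestFunction Ω φ) : Continuous (fderiv ℝ φ) :=
  hφ.contDiff.continuous_fderiv (by simp)

theorem comp_isClosedEmbedding (hφ : IsTestFunction Ω φ) {g : Y → X} (hg : ContDiff ℝ ∞ g)
    (hg' : IsClosedEmbedding g) : IsTestFunction (g ⁻¹' Ω) (φ ∘ g) where
  contDiff := hφ.contDiff.comp hg
  hasCompactSupport := hφ.hasCompactSupport.comp_isClosedEmbedding hg'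
  tsupport_subset := (tsupport_comp_subset_preimage φ hg.continuous).trans
    (preimage_mono hφ.tsupport_subset)
  nonneg y := hφ.nonneg (g y)

theorem mono {Ω₂ : Set X} (hφ : IsTestFunction Ω φ) (h : tsupport φ ⊆ Ω₂) :
    IsTestFunction Ω₂ φ :=
  { hφ with tsupport_subset := h }

theorem slice_left {φ : X × Y → ℝ} (hφ : IsTestFunction (Ω ×ˢ Ω') φ) (y : Y) :
    IsTestFunction Ω fun x => φ (x, y) := by
  have h := hφ.comp_isClosedEmbedding (g := fun x => (x, y)) (by fun_prop)
    (.of_continuous_injective_isClosedMap (by fun_prop) (Prod.mk_left_injective y)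
      (isClosedMap_prodMk_right y))
  exact h.mono fun x hx => (h.tsupport_subset hx).1

theorem slice_right {φ : X × Y → ℝ} (hφ : IsTestFunction (Ω ×ˢ Ω') φ) (x : X) :
    IsTestFunction Ω' fun y => φ (x, y) := by
  have h := hφ.comp_isClosedEmbedding (g := fun y => (x, y)) (by fun_prop)
    (.of_continuous_injective_isClosedMap (by fun_prop) (Prod.mk_right_injective x)
      (isClosedMap_prodMk_left x))
  exact h.mono fun y hy => (h.tsupport_subset hy).2

theorem mul_prod (hψ : IsTestFunction Ω ψ) (hκ : IsTestFunction Ω' κ) :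
    IsTestFunction (Ω ×ˢ Ω') fun z : X × Y => ψ z.1 * κ z.2 := by
  have hsub : tsupport (fun z : X × Y => ψ z.1 * κ z.2) ⊆ tsupport ψ ×ˢ tsupport κ :=
    fun z hz => ⟨tsupport_comp_subset_preimage ψ continuous_fst (tsupport_mul_subset_left hz),
      tsupport_comp_subset_preimage κ continuous_snd (tsupport_mul_subset_right hz)⟩
  refine ⟨(hψ.contDiff.comp contDiff_fst).mul (hκ.contDiff.comp contDiff_snd), ?_,
    hsub.trans (prod_mono hψ.tsupport_subset hκ.tsupport_subset),
    fun z => mul_nonneg (hψ.nonneg z.1) (hκ.nonneg z.2)⟩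
  exact (hψ.hasCompactSupport.isCompact.prod hκ.hasCompactSupport.isCompact).of_isClosed_subset
    (isClosed_tsupport _) hsub

end IsTestFunction

end TestFunction

section BalanceLaw

variable {E : Type*} [NormedAddCommGroup E] [NormedSpace ℝ E]

/-- The coefficients of a balance law `∂ₜu + Div f(t,x,u) = F(t,x,u)` on the whole of `ℝ × E`: a
flux `f` with spatial derivative `Df`, and a source `F`, all jointly continuous. -/
structure BalanceLaw (E : Type*) [NormedAddCommGroup E] [NormedSpace ℝ E] where
  f : ℝ × E → ℝ → E
  Df : ℝ × E → ℝ → E →L[ℝ] E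
  F : ℝ × E → ℝ → ℝ
  continuous_f : Continuous fun z : (ℝ × E) × ℝ => f z.1 z.2
  continuous_Df : Continuous fun z : (ℝ × E) × ℝ => Df z.1 z.2
  continuous_F : Continuous fun z : (ℝ × E) × ℝ => F z.1 z.2
  hasFDerivAt_f : ∀ t x k, HasFDerivAt (fun y => f (t, y) k) (Df (t, x) k) x

attribute [fun_prop] BalanceLaw.continuous_f BalanceLaw.continuous_Df BalanceLaw.continuous_F

namespace BalanceLaw

variable [FiniteDimensional ℝ E] (P : BalanceLaw E)

/-- The partial divergence `div f(t,x,k)`, with `k` fixed. -/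
noncomputable def divf (p : ℝ × E) (k : ℝ) : ℝ := traceCLM E (P.Df p k)

@[fun_prop]
theorem continuous_divf : Continuous fun z : (ℝ × E) × ℝ => P.divf z.1 z.2 := by
  unfold divf
  fun_prop

/-- The integrand of the entropy inequality at `p` up to the factor `sgn (a - k)`, for a solution
with value `a` and a test function with value `c` and derivative `ℓ` at `p`. -/
noncomputable def entropyForm (p : ℝ × E) (a k c : ℝ) (ℓ : ℝ × E →L[ℝ] ℝ) : ℝ :=
  ℓ (a - k, P.f p a - P.f p k) + (P.F p a - P.divf p k) * c

/-- The sum of the integrands of the entropy inequalities for two solutions with values `a` at `z.1`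
and `b` at `z.2`, each taking the value of the other for its constant, up to the factor
`sgn (a - b)`; the test function has value `c` and derivative `L` at `z`. -/
noncomputable def doubledForm (z : (ℝ × E) × (ℝ × E)) (a b c : ℝ)
    (L : (ℝ × E) × (ℝ × E) →L[ℝ] ℝ) : ℝ :=
  L ((a - b, P.f z.1 a - P.f z.1 b), (a - b, P.f z.2 a - P.f z.2 b)) +
    (P.F z.1 a - P.F z.2 b - P.divf z.1 b + P.divf z.2 a) * c

theorem sign_mul_entropyForm_add (z : (ℝ × E) × (ℝ × E)) (a b c : ℝ)
    (L : (ℝ × E) × (ℝ × E) →L[ℝ] ℝ) :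
    Real.sign (a - b) * P.entropyForm z.1 a b c (L.comp (.inl ℝ _ _)) +
      Real.sign (b - a) * P.entropyForm z.2 b a c (L.comp (.inr ℝ _ _)) =
    Real.sign (a - b) * P.doubledForm z a b c L := by
  have hL : L ((a - b, P.f z.1 a - P.f z.1 b), (a - b, P.f z.2 a - P.f z.2 b)) =
      L ((a - b, P.f z.1 a - P.f z.1 b), 0) - L (0, (b - a, P.f z.2 b - P.f z.2 a)) := by
    rw [← map_sub]
    simp
  rw [← neg_sub a b, Real.sign_neg]
  simp only [entropyForm, doubledForm, hL, ContinuousLinearMap.comp_apply,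
    ContinuousLinearMap.inl_apply, ContinuousLinearMap.inr_apply]
  ring

theorem integrable_sign_mul_entropyForm {X : Type*} [TopologicalSpace X]
    [SecondCountableTopology X] [T2Space X] [MeasurableSpace X] [BorelSpace X] (μ : Measure X)
    [IsFiniteMeasureOnCompacts μ] {p : X → ℝ × E} (hp : Continuous p) {a k : X → ℝ}
    (ha : Measurable a) (hk : Measurable k) {C : ℝ}
    (haC : ∀ x, |a x| ≤ C) (hkC : ∀ x, |k x| ≤ C)
    {c : X → ℝ} (hc : Continuous c) {ℓ : X → ℝ × E →L[ℝ] ℝ} (hℓ : Continuous ℓ) {K : Set X}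
    (hK : IsCompact K) (hcK : ∀ x, x ∉ K → c x = 0) (hℓK : ∀ x, x ∉ K → ℓ x = 0) :
    Integrable (fun x => Real.sign (a x - k x) * P.entropyForm (p x) (a x) (k x) (c x) (ℓ x))
      μ := by
  refine integrable_sign_mul μ (G := fun x a k => P.entropyForm (p x) a k (c x) (ℓ x)) ?_ hK
    (fun x hx a b => ?_) ha hk haC hkC
  · unfold entropyForm
    fun_prop
  · simp [entropyForm, hcK x hx, hℓK x hx]

end BalanceLaw

end BalanceLaw

section Doubling

instance isAddHaarMeasure_volume_prod {X Y : Type*} [NormedAddCommGroup X] [MeasureSpace X]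
    [BorelSpace X] [SecondCountableTopology X] [LocallyCompactSpace X]
    [NormedAddCommGroup Y] [MeasureSpace Y] [BorelSpace Y] [SecondCountableTopology Y]
    [LocallyCompactSpace Y] [(volume : Measure X).IsAddHaarMeasure]
    [(volume : Measure Y).IsAddHaarMeasure] : (volume : Measure (X × Y)).IsAddHaarMeasure :=
  Measure.prod.instIsAddHaarMeasure _ _

variable {E : Type*} [NormedAddCommGroup E] [InnerProductSpace ℝ E] [FiniteDimensional ℝ E]
  [MeasurableSpace E] [BorelSpace E] {P : BalanceLaw E} {Ω : Set (ℝ × E)} {u v : ℝ × E → ℝ}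
  {C : ℝ} {φ : (ℝ × E) × (ℝ × E) → ℝ}

/-- The entropy inequalities of a solution `u` of the balance law `P` on `Ω`. -/
def IsEntropic (P : BalanceLaw E) (Ω : Set (ℝ × E)) (u : ℝ × E → ℝ) : Prop :=
  ∀ (k : ℝ) (φ : ℝ × E → ℝ), IsTestFunction Ω φ →
    0 ≤ ∫ p, Real.sign (u p - k) * P.entropyForm p (u p) k (φ p) (fderiv ℝ φ p)

theorem IsEntropic.integral_doubledForm_nonneg (hue : IsEntropic P Ω u) (hve : IsEntropic P Ω v)
    (hu : Measurable u) (hv : Measurable v) (huC : ∀ p, |u p| ≤ C) (hvC : ∀ p, |v p| ≤ C)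
    (hφ : IsTestFunction (Ω ×ˢ Ω) φ) :
    0 ≤ ∫ z : (ℝ × E) × (ℝ × E), Real.sign (u z.1 - v z.2) *
      P.doubledForm z (u z.1) (v z.2) (φ z) (fderiv ℝ φ z) := by
  have hφ' := hφ.continuous_fderiv
  have hφ0 := hφ.contDiff.continuous
  have hK (z) (hz : z ∉ tsupport φ) : φ z = 0 := image_eq_zero_of_notMem_tsupport hz
  have hK' (z) (hz : z ∉ tsupport φ) : fderiv ℝ φ z = 0 := fderiv_of_notMem_tsupport ℝ hz
  have hu_int := P.integrable_sign_mul_entropyForm volume continuous_fst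
    (a := fun z => u z.1) (k := fun z => v z.2) (by fun_prop) (by fun_prop)
    (fun _ => huC _) (fun _ => hvC _) hφ0
    (ℓ := fun z => (fderiv ℝ φ z).comp (.inl ℝ _ _)) (by fun_prop) hφ.hasCompactSupport hK
    (fun z hz => by rw [hK' z hz, ContinuousLinearMap.zero_comp])
  have hv_int := P.integrable_sign_mul_entropyForm volume continuous_snd
    (a := fun z => v z.2) (k := fun z => u z.1) (by fun_prop) (by fun_prop)
    (fun _ => hvC _) (fun _ => huC _) hφ0
    (ℓ := fun z => (fderiv ℝ φ z).comp (.inr ℝ _ _)) (by fun_prop) hφ.hasCompactSupport hK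
    (fun z hz => by rw [hK' z hz, ContinuousLinearMap.zero_comp])
  simp_rw [← P.sign_mul_entropyForm_add]
  rw [integral_add hu_int hv_int, Measure.volume_eq_prod]
  refine add_nonneg ?_ ?_
  · rw [integral_prod_symm _ hu_int]
    refine integral_nonneg fun q => ?_
    have hd (p) : fderiv ℝ (fun p => φ (p, q)) p = (fderiv ℝ φ (p, q)).comp (.inl ℝ _ _) :=
      ((hφ.differentiable (p, q)).hasFDerivAt.comp p (hasFDerivAt_prodMk_left p q)).fderiv
    have h := hue (v q) _ (hφ.slice_left q)
    simp only [hd] at h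
    exact h
  · rw [integral_prod _ hv_int]
    refine integral_nonneg fun p => ?_
    have hd (q) : fderiv ℝ (fun q => φ (p, q)) q = (fderiv ℝ φ (p, q)).comp (.inr ℝ _ _) :=
      ((hφ.differentiable (p, q)).hasFDerivAt.comp q (hasFDerivAt_prodMk_right p q)).fderiv
    have h := hve (u p) _ (hφ.slice_right p)
    simp only [hd] at h
    exact h

end Doubling

section Shear

variable {X : Type*} [NormedAddCommGroup X] [NormedSpace ℝ X]

/-- The change of variables `(p, ζ) ↦ (p, p - S ζ)`, which turns a test function concentrated near
the diagonal into a product. -/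
noncomputable def shear (S : X ≃L[ℝ] X) : (X × X) ≃L[ℝ] (X × X) :=
  ContinuousLinearEquiv.equivOfInverse
    ((ContinuousLinearMap.fst ℝ X X).prod (.fst ℝ X X - (S : X →L[ℝ] X) ∘L .snd ℝ X X))
    ((ContinuousLinearMap.fst ℝ X X).prod
      ((S.symm : X →L[ℝ] X) ∘L (.fst ℝ X X - .snd ℝ X X)))
    (fun z => by simp) (fun z => by simp)

theorem shear_apply (S : X ≃L[ℝ] X) (z : X × X) : shear S z = (z.1, z.1 - S z.2) := rfl

theorem shear_symm_apply (S : X ≃L[ℝ] X) (z : X × X) :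
    (shear S).symm z = (z.1, S.symm (z.1 - z.2)) := rfl

end Shear

namespace BalanceLaw

variable {E : Type*} [NormedAddCommGroup E] [NormedSpace ℝ E] (P : BalanceLaw E)

/-- The increment of the flux between `p - S ζ` and `p`, rescaled by `S`. -/
noncomputable def fluxQuotient (S : (ℝ × E) ≃L[ℝ] (ℝ × E)) (p ζ : ℝ × E) (c : ℝ) : ℝ × E :=
  S.symm (0, P.f p c - P.f (p - S ζ) c)

variable [FiniteDimensional ℝ E]

/-- The doubled integrand for the test function `ψ p * κ ζ` in the sheared variables `p` and
`q = p - S ζ`, up to the factor `sgn (a - b)`; here `c`, `ℓ` are the value and the derivative of `ψ`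
at `p`, and `k`, `m` those of `κ` at `ζ`, while `w` is the rescaled increment of the flux
difference. -/
noncomputable def shearedForm (p q : ℝ × E) (a b c k : ℝ) (ℓ m : ℝ × E →L[ℝ] ℝ) (w : ℝ × E) : ℝ :=
  (ℓ (a - b, P.f p a - P.f p b) + (P.F p a - P.F q b - P.divf p b + P.divf q a) * c) * k + c * m w

theorem doubledForm_shear (S : (ℝ × E) ≃L[ℝ] (ℝ × E)) (z : (ℝ × E) × (ℝ × E)) (a b c k : ℝ)
    (ℓ m : ℝ × E →L[ℝ] ℝ) :
    P.doubledForm (shear S z) a b (c * k)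
        ((c • m ∘L .snd ℝ _ _ + k • ℓ ∘L .fst ℝ _ _) ∘L (shear S).symm) =
      P.shearedForm z.1 (z.1 - S z.2) a b c k ℓ m
        (P.fluxQuotient S z.1 z.2 a - P.fluxQuotient S z.1 z.2 b) := by
  have hinc : ((a - b, P.f z.1 a - P.f z.1 b) : ℝ × E) -
      (a - b, P.f (z.1 - S z.2) a - P.f (z.1 - S z.2) b) =
      (0, P.f z.1 a - P.f (z.1 - S z.2) a) - (0, P.f z.1 b - P.f (z.1 - S z.2) b) := by
    ext <;> simp [sub_sub_sub_comm]
  simp only [doubledForm, shearedForm, fluxQuotient, shear_apply, ← map_sub S.symm, ← hinc]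
  simp only [ContinuousLinearMap.comp_apply, ContinuousLinearEquiv.coe_coe, shear_symm_apply,
    add_apply, smul_apply, ContinuousLinearMap.coe_fst',
    ContinuousLinearMap.coe_snd', smul_eq_mul]
  ring

end BalanceLaw

section ShearedDoubling

variable {E : Type*} [NormedAddCommGroup E] [InnerProductSpace ℝ E] [FiniteDimensional ℝ E]
  [MeasurableSpace E] [BorelSpace E] {P : BalanceLaw E} {Ω : Set (ℝ × E)} {u v : ℝ × E → ℝ}
  {C : ℝ} {ψ κ : ℝ × E → ℝ}

theorem IsEntropic.integral_shearedForm_nonneg (hue : IsEntropic P Ω u) (hve : IsEntropic P Ω v)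
    (hu : Measurable u) (hv : Measurable v) (huC : ∀ p, |u p| ≤ C) (hvC : ∀ p, |v p| ≤ C)
    (hψ : IsTestFunction Ω ψ) (hκ : IsTestFunction univ κ) (S : (ℝ × E) ≃L[ℝ] (ℝ × E))
    (hS : ∀ p ∈ tsupport ψ, ∀ ζ ∈ tsupport κ, p - S ζ ∈ Ω) :
    0 ≤ ∫ z : (ℝ × E) × (ℝ × E), Real.sign (u z.1 - v (z.1 - S z.2)) *
      P.shearedForm z.1 (z.1 - S z.2) (u z.1) (v (z.1 - S z.2)) (ψ z.1) (κ z.2)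
        (fderiv ℝ ψ z.1) (fderiv ℝ κ z.2) (P.fluxQuotient S z.1 z.2 (u z.1) -
          P.fluxQuotient S z.1 z.2 (v (z.1 - S z.2))) := by
  set Φ : (ℝ × E) × (ℝ × E) → ℝ := fun z => ψ z.1 * κ z.2
  have hΦ : IsTestFunction (tsupport ψ ×ˢ tsupport κ) Φ :=
    (hψ.mono subset_rfl).mul_prod (hκ.mono subset_rfl)
  have hφ : IsTestFunction (Ω ×ˢ Ω) (Φ ∘ (shear S).symm) := by
    have h := hΦ.comp_isClosedEmbedding (shear S).symm.contDiff
      (shear S).symm.toHomeomorph.isClosedEmbedding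
    refine h.mono fun z hz => ?_
    obtain ⟨hp, hζ⟩ := h.tsupport_subset hz
    rw [shear_symm_apply] at hp hζ
    exact ⟨hψ.tsupport_subset hp, by simpa using hS _ hp _ hζ⟩
  have hderiv (z) : fderiv ℝ (Φ ∘ (shear S).symm) (shear S z) =
      (ψ z.1 • fderiv ℝ κ z.2 ∘L .snd ℝ _ _ + κ z.2 • fderiv ℝ ψ z.1 ∘L .fst ℝ _ _) ∘L
        (shear S).symm := by
    have hΦz := ((hψ.differentiable z.1).hasFDerivAt.comp z hasFDerivAt_fst).mul
      ((hκ.differentiable z.2).hasFDerivAt.comp z hasFDerivAt_snd)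
    refine (HasFDerivAt.comp (shear S z) ?_ (shear S).symm.hasFDerivAt).fderiv
    rw [ContinuousLinearEquiv.symm_apply_apply]
    exact hΦz
  have key := hue.integral_doubledForm_nonneg hve hu hv huC hvC hφ
  have hchange := integral_comp_continuousLinearEquiv volume (shear S)
    fun z => Real.sign (u z.1 - v z.2) * P.doubledForm z (u z.1) (v z.2)
      ((Φ ∘ (shear S).symm) z) (fderiv ℝ (Φ ∘ (shear S).symm) z)
  simp only [hderiv, Function.comp_apply, ContinuousLinearEquiv.symm_apply_apply, Φ,
    P.doubledForm_shear] at hchange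
  refine (mul_nonneg (abs_nonneg _) key).trans_eq hchange.symm

end ShearedDoubling

section Scaling

variable {E : Type*} [NormedAddCommGroup E] [NormedSpace ℝ E]

/-- The anisotropic scaling `(σ, z) ↦ (τ σ, h z)` of time and space. -/
noncomputable def scaling (τ h : ℝˣ) : (ℝ × E) ≃L[ℝ] (ℝ × E) :=
  (ContinuousLinearEquiv.smulLeft τ).prodCongr (ContinuousLinearEquiv.smulLeft h)

theorem scaling_apply (τ h : ℝˣ) (ζ : ℝ × E) :
    scaling τ h ζ = ((τ : ℝ) * ζ.1, (h : ℝ) • ζ.2) := rfl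

theorem scaling_symm_apply_zero_left (τ h : ℝˣ) (w : E) :
    (scaling τ h).symm (0, w) = (0, (h : ℝ)⁻¹ • w) := by
  rw [ContinuousLinearEquiv.symm_apply_eq, scaling_apply]
  simp [smul_smul]

theorem norm_scaling_le (τ h : ℝˣ) :
    ‖(scaling τ h : (ℝ × E) ≃L[ℝ] (ℝ × E)).toContinuousLinearMap‖ ≤ max |(τ : ℝ)| |(h : ℝ)| := by
  refine ContinuousLinearMap.opNorm_le_bound _ (by positivity) fun ζ => max_le ?_ ?_
  · change ‖(τ : ℝ) * ζ.1‖ ≤ _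
    rw [norm_mul]
    exact mul_le_mul (le_max_left _ _) (norm_fst_le ζ) (norm_nonneg _) (by positivity)
  · change ‖(h : ℝ) • ζ.2‖ ≤ _
    rw [norm_smul]
    exact mul_le_mul (le_max_right _ _) (norm_snd_le ζ) (norm_nonneg _) (by positivity)

namespace BalanceLaw

variable (P : BalanceLaw E) {Q : Set ((ℝ × E) × (ℝ × E) × ℝ)} {ε : ℝ}

theorem norm_sub_smul_Df_le {p : ℝ × E} {z : E} {c h : ℝ}
    (H : ∀ s ∈ Icc (0 : ℝ) 1, ‖P.Df p c z - P.Df (p.1, p.2 - (s * h) • z) c z‖ ≤ ε) :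
    ‖P.f p c - P.f (p.1, p.2 - h • z) c - h • P.Df p c z‖ ≤ |h| * ε := by
  have hderiv (s : ℝ) : HasDerivAt
      (fun s : ℝ => P.f (p.1, p.2 - (s * h) • z) c + (s * h) • P.Df p c z)
      (h • (P.Df p c z - P.Df (p.1, p.2 - (s * h) • z) c z)) s := by
    have hsh : HasDerivAt (fun s : ℝ => s * h) h s := hasDerivAt_mul_const h
    have hline := (hsh.smul_const z).const_sub p.2
    refine (((P.hasFDerivAt_f p.1 _ c).comp_hasDerivAt s hline).add
      (hsh.smul_const (P.Df p c z))).congr_deriv ?_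
    rw [map_neg, map_smul, smul_sub]
    abel
  have key := norm_image_sub_le_of_norm_deriv_le_segment_01'
    (fun s _ => (hderiv s).hasDerivWithinAt) fun s hs => by
      rw [norm_smul]
      exact mul_le_mul_of_nonneg_left (H s (Ico_subset_Icc_self hs)) (norm_nonneg h)
  rw [← norm_neg]
  simpa [sub_sub, add_comm, add_sub_assoc] using key

theorem eventually_norm_sub_smul_Df_le (hQ : IsCompact Q) (hε : 0 < ε) :
    ∀ᶠ h : ℝ in 𝓝 0, ∀ y ∈ Q, ‖P.f y.1 y.2.2 - P.f (y.1.1, y.1.2 - h • y.2.1.2) y.2.2 -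
      h • P.Df y.1 y.2.2 y.2.1.2‖ ≤ |h| * ε := by
  have hclose : ∀ᶠ h : ℝ in 𝓝 0, ∀ w ∈ Q ×ˢ Icc (0 : ℝ) 1, ‖P.Df w.1.1 w.1.2.2 w.1.2.1.2 -
      P.Df (w.1.1.1, w.1.1.2 - (w.2 * h) • w.1.2.1.2) w.1.2.2 w.1.2.1.2‖ < ε := by
    refine (hQ.prod isCompact_Icc).eventually_forall_of_forall_eventually fun w _ => ?_
    refine ContinuousAt.eventually_lt (Continuous.continuousAt ?_) continuousAt_const ?_
    · fun_prop
    · simpa using hε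
  filter_upwards [hclose] with h hh y hy
  exact P.norm_sub_smul_Df_le fun s hs => (hh (y, s) ⟨hy, hs⟩).le

theorem eventually_norm_time_sub_le (hQ : IsCompact Q) (h : ℝ) (hε : 0 < ε) :
    ∀ᶠ τ : ℝ in 𝓝 0, ∀ y ∈ Q, ‖P.f (y.1.1, y.1.2 - h • y.2.1.2) y.2.2 -
      P.f (y.1.1 - τ * y.2.1.1, y.1.2 - h • y.2.1.2) y.2.2‖ < ε := by
  refine hQ.eventually_forall_of_forall_eventually fun y _ => ?_
  refine ContinuousAt.eventually_lt (Continuous.continuousAt ?_) continuousAt_const ?_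
  · fun_prop
  · simpa using hε

theorem norm_fluxQuotient_scaling_sub_le {τ h : ℝˣ} {p ζ : ℝ × E} {c δ : ℝ} (hh : 0 < (h : ℝ))
    (hspace : ‖P.f p c - P.f (p.1, p.2 - (h : ℝ) • ζ.2) c - (h : ℝ) • P.Df p c ζ.2‖ ≤ h * ε)
    (htime : ‖P.f (p.1, p.2 - (h : ℝ) • ζ.2) c -
      P.f (p.1 - τ * ζ.1, p.2 - (h : ℝ) • ζ.2) c‖ ≤ h * δ) :
    ‖P.fluxQuotient (scaling τ h) p ζ c - (0, P.Df p c ζ.2)‖ ≤ ε + δ := by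
  have hsplit : P.f p c - P.f (p - scaling τ h ζ) c - (h : ℝ) • P.Df p c ζ.2 =
      (P.f p c - P.f (p.1, p.2 - (h : ℝ) • ζ.2) c - (h : ℝ) • P.Df p c ζ.2) +
      (P.f (p.1, p.2 - (h : ℝ) • ζ.2) c - P.f (p.1 - τ * ζ.1, p.2 - (h : ℝ) • ζ.2) c) := by
    rw [sub_right_comm _ (P.f (p.1, _) c), sub_add_sub_cancel, sub_right_comm]
    rfl
  rw [fluxQuotient, scaling_symm_apply_zero_left, ← dist_eq_norm, dist_prod_same_left,
    dist_eq_norm]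
  calc ‖(h : ℝ)⁻¹ • (P.f p c - P.f (p - scaling τ h ζ) c) - P.Df p c ζ.2‖
      = (h : ℝ)⁻¹ * ‖P.f p c - P.f (p - scaling τ h ζ) c - (h : ℝ) • P.Df p c ζ.2‖ := by
        rw [← norm_smul_of_nonneg (inv_nonneg.2 hh.le), smul_sub _ _ ((h : ℝ) • _),
          inv_smul_smul₀ hh.ne']
    _ ≤ (h : ℝ)⁻¹ * (h * ε + h * δ) := by
        rw [hsplit]
        exact mul_le_mul_of_nonneg_left (norm_add_le_of_le hspace htime) (inv_pos.2 hh).le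
    _ = ε + δ := by rw [← mul_add, inv_mul_cancel_left₀ hh.ne']

/-- The time scale is chosen after the spatial one, so small that the oscillation of `f` in time is
negligible compared with the spatial scale: no regularity in time beyond continuity is available. -/
theorem exists_scaling_tendstoUniformlyOn_fluxQuotient (hQ : IsCompact Q) :
    ∃ S : ℕ → (ℝ × E) ≃L[ℝ] (ℝ × E),
      Tendsto (fun n => (S n).toContinuousLinearMap) atTop (𝓝 0) ∧
      TendstoUniformlyOn (fun n y => P.fluxQuotient (S n) y.1 y.2.1 y.2.2)
        (fun y => (0, P.Df y.1 y.2.2 y.2.1.2)) atTop Q := by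
  let h n : ℝˣ := Units.mk0 (1 / ((n : ℕ) + 1)) Nat.one_div_pos_of_nat.ne'
  have hpos n : 0 < (h n : ℝ) := Nat.one_div_pos_of_nat
  have hlim : Tendsto (fun n => (h n : ℝ)) atTop (𝓝 0) := tendsto_one_div_add_atTop_nhds_zero_nat
  have hτ n : ∃ τ : ℝˣ, |(τ : ℝ)| < h n ∧ ∀ y ∈ Q,
      ‖P.f (y.1.1, y.1.2 - (h n : ℝ) • y.2.1.2) y.2.2 -
        P.f (y.1.1 - τ * y.2.1.1, y.1.2 - (h n : ℝ) • y.2.1.2) y.2.2‖ < h n * h n := by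
    have h₁ := (P.eventually_norm_time_sub_le hQ (h n) (mul_pos (hpos n) (hpos n)))
    have h₂ : ∀ᶠ τ : ℝ in 𝓝 0, |τ| < h n := by
      exact continuousAt_id.abs.eventually_lt continuousAt_const (by simpa using hpos n)
    obtain ⟨τ, ⟨h₁, h₂⟩, hτ⟩ := (((h₁.and h₂).filter_mono nhdsWithin_le_nhds).and
      self_mem_nhdsWithin : ∀ᶠ τ : ℝ in 𝓝[≠] 0, _).exists
    exact ⟨Units.mk0 τ hτ, h₂, h₁⟩
  choose τ hτh hτf using hτ
  refine ⟨fun n => scaling (τ n) (h n), ?_, ?_⟩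
  · refine squeeze_zero_norm (fun n => ?_) hlim
    refine (norm_scaling_le _ _).trans (max_le (hτh n).le (abs_of_pos (hpos n)).le)
  · rw [Metric.tendstoUniformlyOn_iff]
    intro ε hε
    filter_upwards [hlim.eventually (P.eventually_norm_sub_smul_Df_le hQ (half_pos hε)),
      hlim.eventually_lt_const (half_pos hε)] with n hn hhn y hy
    rw [dist_comm, dist_eq_norm]
    have hbound := P.norm_fluxQuotient_scaling_sub_le (hpos n)
      (by simpa only [abs_of_pos (hpos n)] using hn y hy) (hτf n y hy).le
    linarith

end BalanceLaw

end Scaling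

section UniformLimit

theorem tendstoUniformlyOn_comp_continuous {ι α X Y : Type*} [PseudoMetricSpace X] [ProperSpace X]
    [TopologicalSpace α] [UniformSpace Y] {l : Filter ι} {s : Set α} {g : X → Y}
    (hg : Continuous g) (hs : IsCompact s) {F : ι → α → X} {f : α → X} (hf : Continuous f)
    (h : TendstoUniformlyOn F f l s) :
    TendstoUniformlyOn (fun i x => g (F i x)) (fun x => g (f x)) l s := by
  have hfs (x) (hx : x ∈ s) : f x ∈ f '' s := mem_image_of_mem f hx
  refine UniformContinuousOn.comp_tendstoUniformlyOn_eventually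
    (s := Metric.cthickening 1 (f '' s)) ?_
    (fun x hx => Metric.self_subset_cthickening _ (hfs x hx))
    ((hs.image hf).cthickening.uniformContinuousOn_of_continuous hg.continuousOn) h
  filter_upwards [Metric.tendstoUniformlyOn_iff.1 h 1 one_pos] with i hi x hx
  exact Metric.mem_cthickening_of_dist_le _ _ _ _ (hfs x hx) (dist_comm (f x) _ ▸ (hi x hx).le)

theorem tendstoUniformlyOn_prodMk {ι α X Y : Type*} [UniformSpace X] [UniformSpace Y]
    {l : Filter ι} {s : Set α} {F : ι → α → X} {f : α → X} {G : ι → α → Y} {g : α → Y}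
    (hF : TendstoUniformlyOn F f l s) (hG : TendstoUniformlyOn G g l s) :
    TendstoUniformlyOn (fun i x => (F i x, G i x)) (fun x => (f x, g x)) l s :=
  fun U hU => tendsto_diag.eventually ((hF.prodMk hG) U hU)

theorem eventually_forall_sub_apply_mem {X : Type*} [NormedAddCommGroup X] [NormedSpace ℝ X]
    {Q : Set (X × X)} (hQ : IsCompact Q) {U : Set (X × X)} (hU : IsOpen U)
    (h : ∀ z ∈ Q, (z.1, z.1) ∈ U) :
    ∀ᶠ A : X →L[ℝ] X in 𝓝 0, ∀ z ∈ Q, (z.1, z.1 - A z.2) ∈ U := by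
  refine hQ.eventually_forall_of_forall_eventually fun z hz => ?_
  refine ContinuousAt.eventually_mem (Continuous.continuousAt (by fun_prop))
    (hU.mem_nhds ?_)
  simpa using h z hz

theorem tendstoUniformlyOn_sub_apply {ι X : Type*} [NormedAddCommGroup X] [NormedSpace ℝ X]
    {l : Filter ι} {A : ι → X →L[ℝ] X} (hA : Tendsto A l (𝓝 0)) {Q : Set (X × X)}
    (hQ : IsCompact Q) :
    TendstoUniformlyOn (fun i z => z.1 - A i z.2) Prod.fst l Q :=
  Metric.tendstoUniformlyOn_iff.2 fun ε hε =>
    hA.eventually (eventually_forall_sub_apply_mem hQ (U := {w | dist w.1 w.2 < ε})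
      (isOpen_lt continuous_dist continuous_const) fun z _ => by simpa using hε)

theorem tendsto_integral_sign_mul {X : Type*} [TopologicalSpace X] [MeasurableSpace X]
    [OpensMeasurableSpace X] {μ : Measure X} [IsFiniteMeasureOnCompacts μ]
    {K : Set X} (hK : IsCompact K) (hKm : MeasurableSet K) {C : ℝ} {H : ℕ → X → ℝ → ℝ → ℝ}
    {G : X → ℝ → ℝ → ℝ} (hG : Continuous fun z : X × ℝ × ℝ => G z.1 z.2.1 z.2.2)
    (hHG : TendstoUniformlyOn (fun n z => H n z.1 z.2.1 z.2.2) (fun z => G z.1 z.2.1 z.2.2) atTop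
      (K ×ˢ Icc (-C) C ×ˢ Icc (-C) C))
    (hHK : ∀ n x, x ∉ K → ∀ a b, H n x a b = 0) (hGK : ∀ x, x ∉ K → ∀ a b, G x a b = 0)
    (hdiag : ∀ x a, G x a a = 0) {u v : X → ℝ} {w : ℕ → X → ℝ} (huC : ∀ x, |u x| ≤ C)
    (hwC : ∀ n x, |w n x| ≤ C)
    (hwv : ∀ᵐ x ∂μ, x ∈ K → Tendsto (fun n => w n x) atTop (𝓝 (v x)))
    (hmeas : ∀ n, AEStronglyMeasurable
      (fun x => Real.sign (u x - w n x) * H n x (u x) (w n x)) μ) :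
    Tendsto (fun n => ∫ x, Real.sign (u x - w n x) * H n x (u x) (w n x) ∂μ) atTop
      (𝓝 (∫ x, Real.sign (u x - v x) * G x (u x) (v x) ∂μ)) := by
  obtain ⟨M, hM⟩ := (hK.prod (isCompact_Icc.prod isCompact_Icc)).exists_bound_of_continuousOn
    (s := K ×ˢ Icc (-C) C ×ˢ Icc (-C) C) hG.continuousOn
  refine tendsto_integral_filter_of_dominated_convergence (K.indicator fun _ => M + 1)
    (.of_forall hmeas) ?_ ?_ ?_
  · filter_upwards [Metric.tendstoUniformlyOn_iff.1 hHG 1 one_pos] with n hn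
    refine .of_forall fun x => (abs_sign_mul_le _ _).trans ?_
    by_cases hx : x ∈ K
    · have hmem : (x, u x, w n x) ∈ K ×ˢ Icc (-C) C ×ˢ Icc (-C) C :=
        ⟨hx, abs_le.1 (huC x), abs_le.1 (hwC n x)⟩
      rw [indicator_of_mem hx]
      have hdist : |H n x (u x) (w n x) - G x (u x) (w n x)| ≤ 1 :=
        Real.dist_eq _ _ ▸ dist_comm (G _ _ _) _ ▸ (hn _ hmem).le
      have hMx : |G x (u x) (w n x)| ≤ M := hM _ hmem
      linarith [abs_sub_abs_le_abs_sub (H n x (u x) (w n x)) (G x (u x) (w n x))]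
    · rw [indicator_of_notMem hx, hHK n x hx, abs_zero]
  · exact (integrable_indicator_iff hKm).2 (integrableOn_const hK.measure_lt_top.ne)
  · filter_upwards [hwv] with x hx
    by_cases hxK : x ∈ K
    · refine tendsto_sign_mul (tendsto_const_nhds.sub (hx hxK)) ?_ fun h => ?_
      · refine hHG.tendsto_comp (g := fun n => (x, u x, w n x)) (x := (x, u x, v x))
          hG.continuousWithinAt (tendsto_nhdsWithin_iff.2 ⟨?_, .of_forall fun n =>
            ⟨hxK, abs_le.1 (huC x), abs_le.1 (hwC n x)⟩⟩)
        exact tendsto_const_nhds.prodMk_nhds (tendsto_const_nhds.prodMk_nhds (hx hxK))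
      · rw [← sub_eq_zero.1 h, hdiag]
    · simp only [hHK _ x hxK, hGK x hxK, mul_zero]
      exact tendsto_const_nhds

theorem exists_subseq_ae_tendsto_sub_apply {X : Type*} [NormedAddCommGroup X] [NormedSpace ℝ X]
    [FiniteDimensional ℝ X] [MeasureSpace X] [BorelSpace X]
    [(volume : Measure X).IsAddHaarMeasure] {v : X → ℝ} (hv : Measurable v) {C : ℝ}
    (hvC : ∀ p, |v p| ≤ C) {K L : Set X} (hK : IsCompact K) (hL : IsCompact L)
    {A : ℕ → X →L[ℝ] X} (hA : Tendsto A atTop (𝓝 0)) :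
    ∃ φ : ℕ → ℕ, StrictMono φ ∧ ∀ᵐ z : X × X, z ∈ K ×ˢ L →
      Tendsto (fun n => v (z.1 - A (φ n) z.2)) atTop (𝓝 (v z.1)) := by
  have hv_loc : LocallyIntegrable v :=
    (memLp_top_of_bound hv.aestronglyMeasurable C (.of_forall hvC)).locallyIntegrable le_top
  have hfin : IsFiniteMeasure ((volume : Measure X).restrict L) :=
    isFiniteMeasure_restrict.2 hL.measure_lt_top.ne
  obtain ⟨φ, hφ, hae⟩ := exists_subseq_ae_tendsto_translate volume (volume.restrict L)
    hv.stronglyMeasurable hv_loc hK (S := fun n ζ => A n ζ)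
    (fun n => (A n).continuous.measurable)
    fun ζ => by
      simpa [Function.comp_def] using
        ((ContinuousLinearMap.apply ℝ X ζ).continuous.tendsto 0).comp hA
  refine ⟨φ, hφ, ?_⟩
  rw [← Measure.restrict_univ (μ := volume), Measure.prod_restrict, Measure.restrict_univ,
    ae_restrict_iff' (MeasurableSet.univ.prod hL.measurableSet)] at hae
  filter_upwards [hae] with z hz hzKL
  exact hz ⟨mem_univ _, hzKL.2⟩ hzKL.1

end UniformLimit

section Kato

namespace BalanceLaw

variable {E : Type*} [NormedAddCommGroup E] [NormedSpace ℝ E] [FiniteDimensional ℝ E]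
  (P : BalanceLaw E)

theorem exists_scaling_tendstoUniformlyOn_shearedForm {Ω Ω' : Set (ℝ × E)} {ψ κ : ℝ × E → ℝ}
    (hψ : IsTestFunction Ω ψ) (hκ : IsTestFunction Ω' κ) (C : ℝ) :
    ∃ S : ℕ → (ℝ × E) ≃L[ℝ] (ℝ × E),
      Tendsto (fun n => (S n).toContinuousLinearMap) atTop (𝓝 0) ∧
      TendstoUniformlyOn (fun n (y : ((ℝ × E) × (ℝ × E)) × ℝ × ℝ) =>
          P.shearedForm y.1.1 (y.1.1 - S n y.1.2) y.2.1 y.2.2 (ψ y.1.1) (κ y.1.2)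
            (fderiv ℝ ψ y.1.1) (fderiv ℝ κ y.1.2)
            (P.fluxQuotient (S n) y.1.1 y.1.2 y.2.1 - P.fluxQuotient (S n) y.1.1 y.1.2 y.2.2))
        (fun y => P.shearedForm y.1.1 y.1.1 y.2.1 y.2.2 (ψ y.1.1) (κ y.1.2)
          (fderiv ℝ ψ y.1.1) (fderiv ℝ κ y.1.2)
          (0, (P.Df y.1.1 y.2.1 - P.Df y.1.1 y.2.2) y.1.2.2))
        atTop ((tsupport ψ ×ˢ tsupport κ) ×ˢ Icc (-C) C ×ˢ Icc (-C) C) := by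
  have hK : IsCompact (tsupport ψ ×ˢ tsupport κ) :=
    hψ.hasCompactSupport.isCompact.prod hκ.hasCompactSupport.isCompact
  obtain ⟨S, hS, hquot⟩ := P.exists_scaling_tendstoUniformlyOn_fluxQuotient
    (hψ.hasCompactSupport.isCompact.prod (hκ.hasCompactSupport.isCompact.prod
      (isCompact_Icc (a := -C) (b := C))))
  refine ⟨S, hS, ?_⟩
  have hψ_cont := hψ.contDiff.continuous
  have hκ_cont := hκ.contDiff.continuous
  have hψ' := hψ.continuous_fderiv
  have hκ' := hκ.continuous_fderiv
  have hg : Continuous fun w : (((ℝ × E) × (ℝ × E)) × ℝ × ℝ) × (ℝ × E) × (ℝ × E) × (ℝ × E) =>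
      P.shearedForm w.1.1.1 w.2.1 w.1.2.1 w.1.2.2 (ψ w.1.1.1) (κ w.1.1.2)
        (fderiv ℝ ψ w.1.1.1) (fderiv ℝ κ w.1.1.2) (w.2.2.1 - w.2.2.2) := by
    unfold shearedForm
    fun_prop
  set Q := (tsupport ψ ×ˢ tsupport κ) ×ˢ Icc (-C) C ×ˢ Icc (-C) C
  have hid : TendstoUniformlyOn (fun (_ : ℕ) y => y) id atTop Q :=
    fun U hU => .of_forall fun _ _ _ => refl_mem_uniformity hU
  have htrans := ((tendstoUniformlyOn_sub_apply hS hK).comp Prod.fst).mono (s' := Q)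
    fun y hy => hy.1
  have hquot_a := (hquot.comp fun y : ((ℝ × E) × (ℝ × E)) × ℝ × ℝ => (y.1.1, y.1.2, y.2.1)).mono
    (s' := Q) fun y hy => ⟨hy.1.1, hy.1.2, hy.2.1⟩
  have hquot_b := (hquot.comp fun y : ((ℝ × E) × (ℝ × E)) × ℝ × ℝ => (y.1.1, y.1.2, y.2.2)).mono
    (s' := Q) fun y hy => ⟨hy.1.1, hy.1.2, hy.2.2⟩
  have h := tendstoUniformlyOn_comp_continuous hg (hK.prod (isCompact_Icc.prod isCompact_Icc))
    (f := fun y : ((ℝ × E) × (ℝ × E)) × ℝ × ℝ => (y, y.1.1, ((0 : ℝ), P.Df y.1.1 y.2.1 y.1.2.2),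
      ((0 : ℝ), P.Df y.1.1 y.2.2 y.1.2.2))) (by fun_prop)
    (tendstoUniformlyOn_prodMk hid
      (tendstoUniformlyOn_prodMk htrans (tendstoUniformlyOn_prodMk hquot_a hquot_b)))
  simpa only [Function.comp_apply, Prod.mk_sub_mk, sub_zero, ← sub_apply,
    ContinuousLinearEquiv.coe_coe] using h

theorem shearedForm_eq_zero {ψ κ : ℝ × E → ℝ} {z : (ℝ × E) × (ℝ × E)}
    (hz : z ∉ tsupport ψ ×ˢ tsupport κ) (q : ℝ × E) (a b : ℝ) (w : ℝ × E) :
    P.shearedForm z.1 q a b (ψ z.1) (κ z.2) (fderiv ℝ ψ z.1) (fderiv ℝ κ z.2) w = 0 := by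
  rcases not_and_or.1 hz with h | h
  · simp [shearedForm, image_eq_zero_of_notMem_tsupport h, fderiv_of_notMem_tsupport ℝ h]
  · simp [shearedForm, image_eq_zero_of_notMem_tsupport h, fderiv_of_notMem_tsupport ℝ h]

end BalanceLaw

variable {E : Type*} [NormedAddCommGroup E] [InnerProductSpace ℝ E] [FiniteDimensional ℝ E]
  [MeasurableSpace E] [BorelSpace E] {P : BalanceLaw E} {Ω : Set (ℝ × E)} {u v : ℝ × E → ℝ}
  {C : ℝ} {ψ κ : ℝ × E → ℝ}

theorem IsEntropic.integral_diagonal_shearedForm_nonneg (hue : IsEntropic P Ω u)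
    (hve : IsEntropic P Ω v) (hu : Measurable u) (hv : Measurable v) (huC : ∀ p, |u p| ≤ C)
    (hvC : ∀ p, |v p| ≤ C) (hΩ : IsOpen Ω) (hψ : IsTestFunction Ω ψ)
    (hκ : IsTestFunction univ κ) :
    0 ≤ ∫ z : (ℝ × E) × (ℝ × E), Real.sign (u z.1 - v z.1) *
      P.shearedForm z.1 z.1 (u z.1) (v z.1) (ψ z.1) (κ z.2) (fderiv ℝ ψ z.1) (fderiv ℝ κ z.2)
        (0, (P.Df z.1 (u z.1) - P.Df z.1 (v z.1)) z.2.2) := by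
  have hK : IsCompact (tsupport ψ ×ˢ tsupport κ) :=
    hψ.hasCompactSupport.isCompact.prod hκ.hasCompactSupport.isCompact
  obtain ⟨S, hS, hunif⟩ := P.exists_scaling_tendstoUniformlyOn_shearedForm hψ hκ C
  obtain ⟨φ, hφ, hae⟩ := exists_subseq_ae_tendsto_sub_apply hv hvC hψ.hasCompactSupport.isCompact
    hκ.hasCompactSupport.isCompact hS
  have hψ_cont := hψ.contDiff.continuous
  have hκ_cont := hκ.contDiff.continuous
  have hψ' := hψ.continuous_fderiv
  have hκ' := hκ.continuous_fderiv
  have hlim := tendsto_integral_sign_mul (μ := volume) hK hK.measurableSet (C := C)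
    (H := fun n z a b => P.shearedForm z.1 (z.1 - S (φ n) z.2) a b (ψ z.1) (κ z.2)
      (fderiv ℝ ψ z.1) (fderiv ℝ κ z.2)
      (P.fluxQuotient (S (φ n)) z.1 z.2 a - P.fluxQuotient (S (φ n)) z.1 z.2 b))
    (G := fun z a b => P.shearedForm z.1 z.1 a b (ψ z.1) (κ z.2) (fderiv ℝ ψ z.1)
      (fderiv ℝ κ z.2) (0, (P.Df z.1 a - P.Df z.1 b) z.2.2))
    (u := fun z => u z.1) (v := fun z => v z.1) (w := fun n z => v (z.1 - S (φ n) z.2))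
    (by unfold BalanceLaw.shearedForm; fun_prop)
    (fun U hU => hφ.tendsto_atTop.eventually (hunif U hU))
    (fun n z hz a b => P.shearedForm_eq_zero hz _ a b _)
    (fun z hz a b => P.shearedForm_eq_zero hz _ a b _)
    (fun z a => by simp [BalanceLaw.shearedForm, Prod.mk_zero_zero]) (fun _ => huC _)
    (fun _ _ => hvC _) hae fun n => ?_
  · refine ge_of_tendsto hlim ((hφ.tendsto_atTop.eventually (hS.eventually
      (eventually_forall_sub_apply_mem hK (hΩ.preimage continuous_snd)
        fun z hz => hψ.tsupport_subset hz.1))).mono fun n hn => ?_)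
    exact hue.integral_shearedForm_nonneg hve hu hv huC hvC hψ hκ (S (φ n))
      fun p hp ζ hζ => hn (p, ζ) ⟨hp, hζ⟩
  · refine (integrable_sign_mul volume (G := fun z a b => P.shearedForm z.1 (z.1 - S (φ n) z.2) a b
      (ψ z.1) (κ z.2) (fderiv ℝ ψ z.1) (fderiv ℝ κ z.2)
      (P.fluxQuotient (S (φ n)) z.1 z.2 a - P.fluxQuotient (S (φ n)) z.1 z.2 b))
      ?_ hK (fun z hz a b => P.shearedForm_eq_zero hz _ a b _) (u := fun z => u z.1)
      (v := fun z => v (z.1 - S (φ n) z.2)) (by fun_prop) (by fun_prop) (fun _ => huC _)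
      fun _ => hvC _).aestronglyMeasurable
    unfold BalanceLaw.shearedForm BalanceLaw.fluxQuotient
    fun_prop

theorem BalanceLaw.integral_diagonal_shearedForm (P : BalanceLaw E) (p : ℝ × E) (a b c : ℝ)
    (ℓ : ℝ × E →L[ℝ] ℝ) (hκ : IsTestFunction univ κ) (hκ_int : ∫ ζ, κ ζ = 1) :
    ∫ ζ, P.shearedForm p p a b c (κ ζ) ℓ (fderiv ℝ κ ζ) (0, (P.Df p a - P.Df p b) ζ.2) =
      ℓ (a - b, P.f p a - P.f p b) + (P.F p a - P.F p b) * c := by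
  set A : ℝ × E →L[ℝ] ℝ × E := (0 : ℝ →L[ℝ] ℝ).prodMap (P.Df p a - P.Df p b)
  have hκ' := hκ.continuous_fderiv
  have hint : Integrable fun ζ => fderiv ℝ κ ζ (A ζ) := by
    refine Continuous.integrable_of_hasCompactSupport (by fun_prop) ?_
    exact (hκ.hasCompactSupport.fderiv ℝ).mono fun ζ hζ h => hζ (by simp [h])
  have htrace : ∫ ζ, fderiv ℝ κ ζ (A ζ) = -(P.divf p a - P.divf p b) := by
    rw [integral_fderiv_linear_field volume (hκ.contDiff.of_le (by simp))
      hκ.hasCompactSupport, hκ_int, traceCLM_zero_prodMap, map_sub, mul_one, divf, divf]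
  change ∫ ζ, (_ * κ ζ + c * fderiv ℝ κ ζ (A ζ)) = _
  rw [integral_add ((hκ.contDiff.continuous.integrable_of_hasCompactSupport
    hκ.hasCompactSupport).const_mul _) (hint.const_mul _), integral_const_mul, integral_const_mul,
    hκ_int, htrace]
  ring

theorem IsEntropic.integral_kato_nonneg (hue : IsEntropic P Ω u) (hve : IsEntropic P Ω v)
    (hu : Measurable u) (hv : Measurable v) (huC : ∀ p, |u p| ≤ C) (hvC : ∀ p, |v p| ≤ C)
    (hΩ : IsOpen Ω) (hψ : IsTestFunction Ω ψ) :
    0 ≤ ∫ p, Real.sign (u p - v p) *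
      (fderiv ℝ ψ p (u p - v p, P.f p (u p) - P.f p (v p)) +
        (P.F p (u p) - P.F p (v p)) * ψ p) := by
  let bump : ContDiffBump (0 : ℝ × E) := ⟨1 / 2, 1, by norm_num, by norm_num⟩
  set κ := bump.normed volume
  have hκ : IsTestFunction univ κ :=
    ⟨bump.contDiff_normed, bump.hasCompactSupport_normed, subset_univ _, bump.nonneg_normed⟩
  have hκ_int : ∫ ζ, κ ζ = 1 := bump.integral_normed
  have hψ_cont := hψ.contDiff.continuous
  have hκ_cont := hκ.contDiff.continuous
  have hψ' := hψ.continuous_fderiv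
  have hκ' := hκ.continuous_fderiv
  have key := hue.integral_diagonal_shearedForm_nonneg hve hu hv huC hvC hΩ hψ hκ
  have hint := integrable_sign_mul (volume : Measure ((ℝ × E) × (ℝ × E)))
    (G := fun z a b => P.shearedForm z.1 z.1 a b (ψ z.1) (κ z.2) (fderiv ℝ ψ z.1)
      (fderiv ℝ κ z.2) (0, (P.Df z.1 a - P.Df z.1 b) z.2.2))
    (by unfold BalanceLaw.shearedForm; fun_prop)
    (hψ.hasCompactSupport.isCompact.prod hκ.hasCompactSupport.isCompact)
    (fun z hz a b => P.shearedForm_eq_zero hz _ a b _) (u := fun z => u z.1)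
    (v := fun z => v z.1) (by fun_prop) (by fun_prop) (fun _ => huC _) (fun _ => hvC _)
  rw [Measure.volume_eq_prod, integral_prod _ hint] at key
  simpa only [integral_const_mul, P.integral_diagonal_shearedForm _ _ _ _ _ hκ hκ_int] using key

end Kato

section WeaklyAntitone

/-- A smooth cutoff that vanishes for `t ≤ δ` and equals `1` for `2 * δ ≤ t`. -/
noncomputable def ramp (δ t : ℝ) : ℝ := Real.smoothTransition (t / δ - 1)

/-- A smooth function that is positive before `τ`, vanishes from `τ` on, and satisfies
`decay' ≤ -decay`. -/
noncomputable def decay (τ t : ℝ) : ℝ := Real.exp (-t) * Real.smoothTransition (τ - t)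

variable {δ τ T : ℝ}

theorem contDiff_ramp : ContDiff ℝ ∞ (ramp δ) :=
  Real.smoothTransition.contDiff.comp (by fun_prop)

theorem ramp_nonneg (t : ℝ) : 0 ≤ ramp δ t := Real.smoothTransition.nonneg _

theorem monotone_ramp (hδ : 0 < δ) : Monotone (ramp δ) := fun s t hst =>
  Real.smoothTransition.monotone (by gcongr)

theorem ramp_anti {δ' t : ℝ} (hδ : 0 < δ) (hδδ' : δ ≤ δ') (ht : 0 ≤ t) : ramp δ' t ≤ ramp δ t :=
  Real.smoothTransition.monotone (by gcongr)

theorem ramp_of_le (hδ : 0 < δ) {t : ℝ} (ht : t ≤ δ) : ramp δ t = 0 :=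
  Real.smoothTransition.zero_of_nonpos (sub_nonpos.2 ((div_le_one hδ).2 ht))

theorem ramp_of_ge (hδ : 0 < δ) {t : ℝ} (ht : 2 * δ ≤ t) : ramp δ t = 1 :=
  Real.smoothTransition.one_of_one_le (le_sub_iff_add_le.2 ((le_div_iff₀ hδ).2 (by linarith)))

theorem deriv_ramp_of_gt (hδ : 0 < δ) {t : ℝ} (ht : 2 * δ < t) : deriv (ramp δ) t = 0 := by
  have h : ramp δ =ᶠ[𝓝 t] fun _ => 1 := by
    filter_upwards [Ioi_mem_nhds ht] with s hs using ramp_of_ge hδ (le_of_lt hs)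
  rw [h.deriv_eq, deriv_const]

theorem contDiff_decay : ContDiff ℝ ∞ (decay τ) :=
  (Real.contDiff_exp.comp contDiff_neg).mul (Real.smoothTransition.contDiff.comp (by fun_prop))

theorem decay_nonneg (t : ℝ) : 0 ≤ decay τ t :=
  mul_nonneg (Real.exp_pos _).le (Real.smoothTransition.nonneg _)

theorem decay_pos {t : ℝ} (ht : t < τ) : 0 < decay τ t :=
  mul_pos (Real.exp_pos _) (Real.smoothTransition.pos_of_pos (sub_pos.2 ht))

theorem decay_le_one {t : ℝ} (ht : 0 ≤ t) : decay τ t ≤ 1 :=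
  mul_le_one₀ (Real.exp_le_one_iff.2 (neg_nonpos.2 ht)) (Real.smoothTransition.nonneg _)
    (Real.smoothTransition.le_one _)

theorem decay_of_ge {t : ℝ} (ht : τ ≤ t) : decay τ t = 0 := by
  rw [decay, Real.smoothTransition.zero_of_nonpos (sub_nonpos.2 ht), mul_zero]

theorem deriv_decay_le (t : ℝ) : deriv (decay τ) t ≤ -decay τ t := by
  have hexp : HasDerivAt (fun t => Real.exp (-t)) (-Real.exp (-t)) t := by
    simpa using (hasDerivAt_neg t).exp
  have hσ : DifferentiableAt ℝ Real.smoothTransition (τ - t) :=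
    (Real.smoothTransition.contDiff (n := 1)).differentiable (by simp) _
  have h := (hexp.mul (hσ.hasDerivAt.comp_const_sub τ t)).deriv
  have hmono := mul_nonneg (Real.exp_pos (-t)).le
    (Real.smoothTransition.monotone.deriv_nonneg (x := τ - t))
  simp only [decay] at h ⊢
  linarith [show deriv (decay τ) t = _ from h]

theorem isTestFunction_ramp_mul_decay (hδ : 0 < δ) (hτ : τ < T) :
    IsTestFunction (Ioo 0 T) fun t => ramp δ t * decay τ t := by
  have hzero (t) (ht : t ∉ Icc δ τ) : ramp δ t * decay τ t = 0 := by
    rcases not_and_or.1 ht with ht | ht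
    · rw [ramp_of_le hδ (not_le.1 ht).le, zero_mul]
    · rw [decay_of_ge (not_le.1 ht).le, mul_zero]
  exact ⟨contDiff_ramp.mul contDiff_decay, .intro isCompact_Icc hzero,
    (closure_minimal (Function.support_subset_iff'.2 hzero) isClosed_Icc).trans
      (Icc_subset_Ioo hδ hτ), fun t => mul_nonneg (ramp_nonneg t) (decay_nonneg t)⟩

theorem deriv_ramp_mul_decay_le (t : ℝ) : deriv (fun t => ramp δ t * decay τ t) t ≤
    deriv (ramp δ) t * decay τ t - ramp δ t * decay τ t := by
  rw [deriv_fun_mul (contDiff_ramp.differentiable (by simp) t)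
    (contDiff_decay.differentiable (by simp) t)]
  linarith [mul_le_mul_of_nonneg_left (deriv_decay_le (τ := τ) t) (ramp_nonneg (δ := δ) t)]

theorem integral_deriv_ramp_le_one (hδ : 0 < δ) (hT : 0 ≤ T) :
    ∫ t in Ioo 0 T, deriv (ramp δ) t ≤ 1 := by
  rw [← integral_Ioc_eq_integral_Ioo, ← intervalIntegral.integral_of_le hT,
    intervalIntegral.integral_deriv_eq_sub (fun t _ => contDiff_ramp.differentiable (by simp) t)
      ((contDiff_ramp.continuous_deriv (by simp)).intervalIntegrable _ _),
    ramp_of_le hδ hδ.le, sub_zero]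
  exact Real.smoothTransition.le_one _

variable {m : ℝ → ℝ}

theorem integrableOn_mul_ramp_mul_decay (hm : IntegrableOn m (Ioo 0 T)) (δ τ : ℝ) :
    IntegrableOn (fun t => m t * (ramp δ t * decay τ t)) (Ioo 0 T) := by
  have hcont := (contDiff_ramp (δ := δ)).continuous.mul (contDiff_decay (τ := τ)).continuous
  refine Integrable.mul_bdd (c := 1) hm hcont.aestronglyMeasurable ?_
  filter_upwards [ae_restrict_mem measurableSet_Ioo] with t ht
  rw [Real.norm_of_nonneg (mul_nonneg (ramp_nonneg t) (decay_nonneg t))]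
  exact mul_le_one₀ (Real.smoothTransition.le_one _) (decay_nonneg t) (decay_le_one ht.1.le)

theorem integral_mul_ramp_mul_decay_le (hT : 0 < T) (hm : IntegrableOn m (Ioo 0 T))
    (hm0 : ∀ t, 0 ≤ m t)
    (hweak : ∀ χ, IsTestFunction (Ioo 0 T) χ → 0 ≤ ∫ t in Ioo 0 T, m t * deriv χ t)
    {ε δ₀ : ℝ} (hε : 0 ≤ ε) (hinit : ∀ᵐ t, t ∈ Ioo 0 δ₀ → m t ≤ ε) (hδ : 0 < δ)
    (hδ₀ : 2 * δ < δ₀) (hτ : τ < T) :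
    ∫ t in Ioo 0 T, m t * (ramp δ t * decay τ t) ≤ ε := by
  have hχ := isTestFunction_ramp_mul_decay hδ hτ
  have hramp' : Continuous (deriv (ramp δ)) := contDiff_ramp.continuous_deriv (by simp)
  have hlayer : ∀ᵐ t ∂volume.restrict (Ioo 0 T),
      m t * (deriv (ramp δ) t * decay τ t) ≤ ε * deriv (ramp δ) t := by
    filter_upwards [ae_restrict_of_ae hinit, ae_restrict_mem measurableSet_Ioo] with t hmt ht
    by_cases htδ : t < δ₀
    · have h0 := (monotone_ramp hδ).deriv_nonneg (x := t)
      exact mul_le_mul (hmt ⟨ht.1, htδ⟩) (mul_le_of_le_one_right h0 (decay_le_one ht.1.le))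
        (mul_nonneg h0 (decay_nonneg t)) hε
    · simp [deriv_ramp_of_gt hδ (hδ₀.trans_le (not_lt.1 htδ))]
  have hχ_int : IntegrableOn (fun t => m t * deriv (fun t => ramp δ t * decay τ t) t)
      (Ioo 0 T) := by
    obtain ⟨c, hc⟩ := (hχ.contDiff.continuous_deriv (by simp)).bounded_above_of_compact_support
      hχ.hasCompactSupport.deriv
    exact Integrable.mul_bdd (c := c) hm
      (hχ.contDiff.continuous_deriv (by simp)).aestronglyMeasurable (.of_forall hc)
  have hramp'_int : IntegrableOn (fun t => ε * deriv (ramp δ) t) (Ioo 0 T) :=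
    ((hramp'.integrableOn_Icc (a := 0) (b := T)).mono_set Ioo_subset_Icc_self).const_mul ε
  have hle := integral_mono_ae hχ_int
    (hramp'_int.sub (integrableOn_mul_ramp_mul_decay hm δ τ)) (by
      filter_upwards [hlayer] with t ht
      have := mul_le_mul_of_nonneg_left (deriv_ramp_mul_decay_le (δ := δ) (τ := τ) t)
        (hm0 t)
      simp only [Pi.sub_apply]
      linarith)
  rw [integral_sub' hramp'_int (integrableOn_mul_ramp_mul_decay hm δ τ),
    integral_const_mul] at hle
  linarith [hweak _ hχ,
    mul_le_mul_of_nonneg_left (integral_deriv_ramp_le_one hδ hT.le) hε]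

theorem ae_mul_ramp_mul_decay_eq_zero (hT : 0 < T) (hm : IntegrableOn m (Ioo 0 T))
    (hm0 : ∀ t, 0 ≤ m t)
    (hweak : ∀ χ, IsTestFunction (Ioo 0 T) χ → 0 ≤ ∫ t in Ioo 0 T, m t * deriv χ t)
    (hinit : ∀ ε > 0, ∃ δ > 0, ∀ᵐ t, t ∈ Ioo 0 δ → m t ≤ ε) (hδ : 0 < δ) (hτ : τ < T) :
    ∀ᵐ t ∂volume.restrict (Ioo 0 T), m t * (ramp δ t * decay τ t) = 0 := by
  have hnonneg (t : ℝ) : 0 ≤ m t * (ramp δ t * decay τ t) :=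
    mul_nonneg (hm0 t) (mul_nonneg (ramp_nonneg t) (decay_nonneg t))
  have hint (δ : ℝ) := integrableOn_mul_ramp_mul_decay hm δ τ
  refine (integral_eq_zero_iff_of_nonneg hnonneg (hint δ)).1
    (le_antisymm (le_of_forall_pos_le_add fun ε hε => ?_) (integral_nonneg hnonneg))
  obtain ⟨δ₀, hδ₀, hmε⟩ := hinit ε hε
  set δ' := min δ (δ₀ / 3)
  have hδ' : 0 < δ' := by positivity
  have h2δ' : 2 * δ' < δ₀ := by linarith [min_le_right δ (δ₀ / 3)]
  calc ∫ t in Ioo 0 T, m t * (ramp δ t * decay τ t)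
      ≤ ∫ t in Ioo 0 T, m t * (ramp δ' t * decay τ t) := by
        refine setIntegral_mono_on (hint δ) (hint δ') measurableSet_Ioo fun t ht => ?_
        exact mul_le_mul_of_nonneg_left (mul_le_mul_of_nonneg_right
          (ramp_anti hδ' (min_le_left δ (δ₀ / 3)) ht.1.le) (decay_nonneg t)) (hm0 t)
    _ ≤ ε := integral_mul_ramp_mul_decay_le hT hm hm0 hweak hε.le hmε hδ' h2δ' hτ
    _ = 0 + ε := (zero_add ε).symm

theorem ae_eq_zero_of_integral_mul_deriv_nonneg (hm : IntegrableOn m (Ioo 0 T))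
    (hm0 : ∀ t, 0 ≤ m t)
    (hweak : ∀ χ, IsTestFunction (Ioo 0 T) χ → 0 ≤ ∫ t in Ioo 0 T, m t * deriv χ t)
    (hinit : ∀ ε > 0, ∃ δ > 0, ∀ᵐ t, t ∈ Ioo 0 δ → m t ≤ ε) :
    ∀ᵐ t, t ∈ Ioo 0 T → m t = 0 := by
  rcases le_or_gt T 0 with hT | hT
  · simp [Ioo_eq_empty_of_le hT]
  have hseq : ∀ᵐ t ∂volume.restrict (Ioo 0 T), ∀ n : ℕ,
      m t * (ramp (1 / (n + 1)) t * decay (T - 1 / (n + 1)) t) = 0 :=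
    ae_all_iff.2 fun n => ae_mul_ramp_mul_decay_eq_zero hT hm hm0 hweak hinit
      Nat.one_div_pos_of_nat (sub_lt_self _ Nat.one_div_pos_of_nat)
  rw [← ae_restrict_iff' measurableSet_Ioo]
  filter_upwards [hseq, ae_restrict_mem measurableSet_Ioo] with t hmt ht
  have hlim : Tendsto (fun n : ℕ => 1 / ((n : ℝ) + 1)) atTop (𝓝 0) :=
    tendsto_one_div_add_atTop_nhds_zero_nat
  obtain ⟨n, hn, hn'⟩ := ((hlim.eventually_lt_const ht.1).and
    (hlim.eventually_lt_const (sub_pos.2 ht.2))).exists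
  have hramp : 0 < ramp (1 / ((n : ℝ) + 1)) t :=
    Real.smoothTransition.pos_of_pos
      (sub_pos.2 ((one_lt_div Nat.one_div_pos_of_nat).2 hn))
  exact (mul_eq_zero.1 (hmt n)).resolve_right
    (mul_pos hramp (decay_pos (lt_sub_comm.1 hn'))).ne'

end WeaklyAntitone

section Cone

variable {E : Type*} [NormedAddCommGroup E] {L M R : ℝ}

/-- The Japanese bracket `⟨x⟩`, a smooth substitute for the norm. -/
noncomputable def bracket (x : E) : ℝ := √(1 + ‖x‖ ^ 2)

theorem norm_le_bracket (x : E) : ‖x‖ ≤ bracket x :=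
  Real.le_sqrt_of_sq_le (by linarith)

/-- A smooth weight that decays exponentially in time and is supported in the backward light cone
`⟨x⟩ + M t ≤ R` of slope `M`. -/
noncomputable def coneWeight (L M R : ℝ) (p : ℝ × E) : ℝ :=
  Real.exp (-L * p.1) * Real.smoothTransition (R - bracket p.2 - M * p.1)

theorem coneWeight_nonneg (p : ℝ × E) : 0 ≤ coneWeight L M R p :=
  mul_nonneg (Real.exp_pos _).le (Real.smoothTransition.nonneg _)

theorem coneWeight_pos {p : ℝ × E} (hp : bracket p.2 + M * p.1 < R) : 0 < coneWeight L M R p :=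
  mul_pos (Real.exp_pos _) (Real.smoothTransition.pos_of_pos (by linarith))

theorem coneWeight_le_one (hL : 0 ≤ L) {p : ℝ × E} (hp : 0 ≤ p.1) : coneWeight L M R p ≤ 1 :=
  mul_le_one₀ (Real.exp_le_one_iff.2 (by rw [neg_mul]; exact neg_nonpos.2 (mul_nonneg hL hp)))
    (Real.smoothTransition.nonneg _) (Real.smoothTransition.le_one _)

theorem coneWeight_eq_zero (hM : 0 ≤ M) {p : ℝ × E} (hp : 0 ≤ p.1) (hpR : R ≤ ‖p.2‖) :
    coneWeight L M R p = 0 := by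
  rw [coneWeight, Real.smoothTransition.zero_of_nonpos, mul_zero]
  linarith [norm_le_bracket p.2, mul_nonneg hM hp]

variable [InnerProductSpace ℝ E]

theorem contDiff_bracket : ContDiff ℝ ∞ (bracket : E → ℝ) :=
  (contDiff_const.add (contDiff_norm_sq ℝ)).sqrt fun x => by positivity

theorem abs_fderiv_bracket_le (x y : E) : |fderiv ℝ bracket x y| ≤ ‖y‖ := by
  have hpos : 0 < bracket x := by unfold bracket; positivity
  have hderiv : fderiv ℝ bracket x y = inner ℝ x y / bracket x := by
    have h := (((hasStrictFDerivAt_norm_sq x).hasFDerivAt.const_add 1).sqrt (by positivity)).fderiv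
    change fderiv ℝ bracket x = _ at h
    rw [h, ← bracket, smul_apply, smul_apply, innerSL_apply_apply, smul_eq_mul, nsmul_eq_mul]
    field_simp
    norm_num
  rw [hderiv, abs_div, abs_of_pos hpos, div_le_iff₀ hpos, mul_comm]
  exact (abs_real_inner_le_norm x y).trans (by gcongr; exact norm_le_bracket x)

theorem contDiff_coneWeight : ContDiff ℝ ∞ (coneWeight L M R : ℝ × E → ℝ) := by
  have := contDiff_bracket (E := E)
  exact (contDiff_const.mul contDiff_fst).exp.mul
    (Real.smoothTransition.contDiff.comp (by fun_prop))

theorem fderiv_coneWeight_le (p : ℝ × E) {s : ℝ} {y : E} (hy : ‖y‖ ≤ M * s) :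
    fderiv ℝ (coneWeight L M R) p (s, y) ≤ -L * s * coneWeight L M R p := by
  set g : ℝ × E → ℝ := fun q => R - bracket q.2 - M * q.1
  have hexp : HasFDerivAt (fun q : ℝ × E => Real.exp (-L * q.1))
      (Real.exp (-L * p.1) • (-L) • .fst ℝ ℝ E) p := (hasFDerivAt_fst.const_mul (-L)).exp
  have hg : HasFDerivAt g
      (-(fderiv ℝ bracket p.2).comp (.snd ℝ ℝ E) - M • .fst ℝ ℝ E) p :=
    (((contDiff_bracket.differentiable (by simp) p.2).hasFDerivAt.comp p
      hasFDerivAt_snd).const_sub R).sub (hasFDerivAt_fst.const_mul M)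
  have hσ : DifferentiableAt ℝ Real.smoothTransition (g p) :=
    (Real.smoothTransition.contDiff (n := 1)).differentiable (by simp) _
  have hderiv := congr($((hexp.mul (hσ.hasDerivAt.comp_hasFDerivAt p hg)).fderiv) (s, y))
  have hdecrease : fderiv ℝ bracket p.2 y + M * s ≥ 0 := by
    linarith [neg_le_of_abs_le (abs_fderiv_bracket_le p.2 y)]
  have hmono := mul_nonneg (Real.exp_pos (-L * p.1)).le
    (mul_nonneg (Real.smoothTransition.monotone.deriv_nonneg (x := g p)) hdecrease)
  change fderiv ℝ (coneWeight L M R) p (s, y) = _ at hderiv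
  simp only [_root_.add_apply, smul_apply, sub_apply, neg_apply, ContinuousLinearMap.comp_apply,
    ContinuousLinearMap.coe_fst', ContinuousLinearMap.coe_snd', smul_eq_mul,
    Function.comp_apply] at hderiv
  rw [hderiv, coneWeight]
  linear_combination hmono

theorem sign_mul_kato_integrand_le {P : BalanceLaw E} {p : ℝ × E} {χ : ℝ → ℝ} {a b : ℝ}
    (hχ : DifferentiableAt ℝ χ p.1) (hχ0 : 0 ≤ χ p.1)
    (hf : ‖P.f p a - P.f p b‖ ≤ M * |a - b|)
    (hF : Real.sign (a - b) * (P.F p a - P.F p b) ≤ L * |a - b|) :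
    Real.sign (a - b) *
      (fderiv ℝ (fun p => χ p.1 * coneWeight L M R p) p (a - b, P.f p a - P.f p b) +
        (P.F p a - P.F p b) * (χ p.1 * coneWeight L M R p)) ≤
    |a - b| * coneWeight L M R p * deriv χ p.1 := by
  set σ := Real.sign (a - b)
  set y := P.f p a - P.f p b
  have hfderiv : fderiv ℝ (fun p => χ p.1 * coneWeight L M R p) p (|a - b|, σ • y) =
      χ p.1 * fderiv ℝ (coneWeight L M R) p (|a - b|, σ • y) +
        coneWeight L M R p * (|a - b| * deriv χ p.1) := by
    have h := ((hχ.hasDerivAt.comp_hasFDerivAt p hasFDerivAt_fst).mul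
      (contDiff_coneWeight (L := L) (M := M) (R := R) |>.differentiable (by simp)
        p).hasFDerivAt).fderiv
    have := congr($h (|a - b|, σ • y))
    simpa [Pi.mul_def, mul_comm] using this
  have hσy : ‖σ • y‖ ≤ M * |a - b| := by
    rw [norm_smul]
    exact (mul_le_of_le_one_left (norm_nonneg _) (abs_sign_le_one _)).trans hf
  have hcone := mul_le_mul_of_nonneg_left
    (fderiv_coneWeight_le (L := L) (R := R) p hσy) hχ0
  have hsource := mul_le_mul_of_nonneg_right hF
    (mul_nonneg hχ0 (coneWeight_nonneg (L := L) (M := M) (R := R) p))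
  rw [mul_add, ← smul_eq_mul, ← map_smul, Prod.smul_mk, smul_eq_mul, sign_mul_self_eq_abs, hfderiv]
  linarith

theorem isTestFunction_mul_coneWeight [FiniteDimensional ℝ E] {T : ℝ} {χ : ℝ → ℝ}
    (hχ : IsTestFunction (Ioo 0 T) χ) (hM : 0 ≤ M) :
    IsTestFunction (Ioo 0 T ×ˢ univ) fun p : ℝ × E => χ p.1 * coneWeight L M R p := by
  have hzero (p : ℝ × E) (hp : p ∉ tsupport χ ×ˢ Metric.closedBall 0 R) :
      χ p.1 * coneWeight L M R p = 0 := by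
    by_cases h : p.1 ∈ tsupport χ
    · have hpR : R ≤ ‖p.2‖ := by
        simpa using (not_le.1 fun h' => hp ⟨h, mem_closedBall_zero_iff.2 h'⟩).le
      rw [coneWeight_eq_zero hM (hχ.tsupport_subset h).1.le hpR, mul_zero]
    · rw [image_eq_zero_of_notMem_tsupport h, zero_mul]
  exact ⟨(hχ.contDiff.comp contDiff_fst).mul contDiff_coneWeight,
    .intro (hχ.hasCompactSupport.isCompact.prod (isCompact_closedBall 0 R)) hzero,
    (tsupport_mul_subset_left.trans (tsupport_comp_subset_preimage χ continuous_fst)).trans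
      fun p hp => ⟨hχ.tsupport_subset hp, mem_univ _⟩,
    fun p => mul_nonneg (hχ.nonneg _) (coneWeight_nonneg _)⟩

end Cone

section Uniqueness

variable {E : Type*} [NormedAddCommGroup E] [InnerProductSpace ℝ E] [FiniteDimensional ℝ E]
  [MeasurableSpace E] [BorelSpace E] {P : BalanceLaw E} {u v w : ℝ × E → ℝ} {C L M R T : ℝ}

theorem integrable_abs_mul_coneWeight (hw : Measurable w) (hwC : ∀ p, |w p| ≤ C) (hL : 0 ≤ L)
    (hM : 0 ≤ M) : Integrable (fun p => |w p| * coneWeight L M R p)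
      ((volume.restrict (Ioo 0 T)).prod (volume : Measure E)) := by
  have hW := (contDiff_coneWeight (E := E) (L := L) (M := M) (R := R)).continuous
  have hbdd : IntegrableOn (fun p => |w p| * coneWeight L M R p)
      (Ioo 0 T ×ˢ Metric.ball 0 R) (volume.prod (volume : Measure E)) := by
    refine Measure.integrableOn_of_bounded (M := C) ?_ ?_ ?_
    · rw [Measure.prod_prod]
      exact ENNReal.mul_ne_top measure_Ioo_lt_top.ne measure_ball_lt_top.ne
    · exact (hw.abs.mul hW.measurable).aestronglyMeasurable
    · filter_upwards [ae_restrict_mem (measurableSet_Ioo.prod measurableSet_ball)] with p hp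
      rw [Real.norm_of_nonneg (mul_nonneg (abs_nonneg _) (coneWeight_nonneg p)), ← mul_one C]
      exact mul_le_mul (hwC p) (coneWeight_le_one hL hp.1.1.le) (coneWeight_nonneg p)
        ((abs_nonneg _).trans (hwC p))
  rw [← Measure.restrict_univ (μ := (volume : Measure E)), Measure.prod_restrict]
  refine hbdd.of_forall_sdiff_eq_zero (measurableSet_Ioo.prod .univ) fun p hp => ?_
  have hpR : R ≤ ‖p.2‖ := by
    simpa using fun h => hp.2 ⟨hp.1.1, h⟩
  rw [coneWeight_eq_zero hM hp.1.1.1.le hpR, mul_zero]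

/-- The weighted mass of `w` at time `t`. -/
noncomputable def coneMass (L M R : ℝ) (w : ℝ × E → ℝ) (t : ℝ) : ℝ :=
  ∫ x, |w (t, x)| * coneWeight L M R (t, x)

theorem coneMass_nonneg (t : ℝ) : 0 ≤ coneMass L M R w t :=
  integral_nonneg fun _ => mul_nonneg (abs_nonneg _) (coneWeight_nonneg _)

theorem integrableOn_coneMass (hw : Measurable w) (hwC : ∀ p, |w p| ≤ C) (hL : 0 ≤ L)
    (hM : 0 ≤ M) : IntegrableOn (coneMass L M R w) (Ioo 0 T) :=
  (integrable_abs_mul_coneWeight hw hwC hL hM).integral_prod_left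

theorem coneMass_le {ε t : ℝ} (hw : Measurable w) (hL : 0 ≤ L) (hM : 0 ≤ M) (ht : 0 ≤ t)
    (hε : 0 ≤ ε) (hwε : ∫⁻ x in Metric.ball 0 R, ‖w (t, x)‖ₑ ≤ ENNReal.ofReal ε) :
    coneMass L M R w t ≤ ε := by
  have hW := (contDiff_coneWeight (E := E) (L := L) (M := M) (R := R)).continuous
  rw [coneMass, integral_eq_lintegral_of_nonneg_ae
    (.of_forall fun _ => mul_nonneg (abs_nonneg _) (coneWeight_nonneg _))
    (((hw.abs.mul hW.measurable).comp measurable_prodMk_left).aestronglyMeasurable)]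
  refine ENNReal.toReal_le_of_le_ofReal hε (le_trans ?_ hwε)
  rw [← lintegral_indicator measurableSet_ball]
  refine lintegral_mono fun x => ?_
  by_cases hx : x ∈ Metric.ball 0 R
  · rw [indicator_of_mem hx, Real.enorm_eq_ofReal_abs]
    exact ENNReal.ofReal_le_ofReal
      (mul_le_of_le_one_right (abs_nonneg _) (coneWeight_le_one hL ht))
  · rw [indicator_of_notMem hx, coneWeight_eq_zero hM ht (by simpa using hx), mul_zero,
      ENNReal.ofReal_zero]

theorem integrable_abs_mul_deriv_mul_coneWeight (hw : Measurable w) (hwC : ∀ p, |w p| ≤ C)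
    (hL : 0 ≤ L) (hM : 0 ≤ M) {χ : ℝ → ℝ} (hχ : IsTestFunction (Ioo 0 T) χ) :
    Integrable fun p : ℝ × E => |w p| * coneWeight L M R p * deriv χ p.1 := by
  have hχ' := hχ.contDiff.continuous_deriv (by simp)
  obtain ⟨c, hc⟩ := hχ'.bounded_above_of_compact_support hχ.hasCompactSupport.deriv
  have hint : IntegrableOn (fun p : ℝ × E => |w p| * coneWeight L M R p * deriv χ p.1)
      (Ioo 0 T ×ˢ univ) := by
    rw [IntegrableOn, Measure.volume_eq_prod, ← Measure.prod_restrict, Measure.restrict_univ]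
    exact (integrable_abs_mul_coneWeight hw hwC hL hM).mul_bdd
      (hχ'.comp continuous_fst).aestronglyMeasurable (.of_forall fun p => hc p.1)
  refine hint.integrable_of_forall_notMem_eq_zero fun p hp => ?_
  rw [deriv_of_notMem_tsupport fun h => hp ⟨hχ.tsupport_subset h, mem_univ _⟩, mul_zero]

theorem integral_abs_mul_deriv_mul_coneWeight (hw : Measurable w) (hwC : ∀ p, |w p| ≤ C)
    (hL : 0 ≤ L) (hM : 0 ≤ M) {χ : ℝ → ℝ} (hχ : IsTestFunction (Ioo 0 T) χ) :
    ∫ p : ℝ × E, |w p| * coneWeight L M R p * deriv χ p.1 =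
      ∫ t in Ioo 0 T, coneMass L M R w t * deriv χ t := by
  have hint := integrable_abs_mul_deriv_mul_coneWeight (R := R) hw hwC hL hM hχ
  rw [Measure.volume_eq_prod, integral_prod _ hint,
    setIntegral_eq_integral_of_forall_compl_eq_zero fun t ht => by
      rw [deriv_of_notMem_tsupport fun h => ht (hχ.tsupport_subset h), mul_zero]]
  simp only [integral_mul_const, coneMass]

theorem abs_sub_apply_le {α : Type*} {u v : α → ℝ} (huC : ∀ p, |u p| ≤ C)
    (hvC : ∀ p, |v p| ≤ C) (p : α) : |(u - v) p| ≤ C + C :=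
  (abs_sub (u p) (v p)).trans (add_le_add (huC p) (hvC p))

theorem BalanceLaw.integrable_kato_integrand (P : BalanceLaw E) {Ω : Set (ℝ × E)} {ψ : ℝ × E → ℝ}
    (hu : Measurable u) (hv : Measurable v) (huC : ∀ p, |u p| ≤ C) (hvC : ∀ p, |v p| ≤ C)
    (hψ : IsTestFunction Ω ψ) :
    Integrable fun p => Real.sign (u p - v p) *
      (fderiv ℝ ψ p (u p - v p, P.f p (u p) - P.f p (v p)) +
        (P.F p (u p) - P.F p (v p)) * ψ p) := by
  have hψ_cont := hψ.contDiff.continuous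
  have hψ' := hψ.continuous_fderiv
  refine integrable_sign_mul volume (G := fun p a b =>
    fderiv ℝ ψ p (a - b, P.f p a - P.f p b) + (P.F p a - P.F p b) * ψ p)
    (by fun_prop) hψ.hasCompactSupport (fun p hp a b => ?_) hu hv huC hvC
  rw [fderiv_of_notMem_tsupport ℝ hp, image_eq_zero_of_notMem_tsupport hp, zero_apply, mul_zero,
    add_zero]

theorem IsEntropic.integral_coneMass_mul_deriv_nonneg (hue : IsEntropic P (Ioo 0 T ×ˢ univ) u)
    (hve : IsEntropic P (Ioo 0 T ×ˢ univ) v) (hu : Measurable u) (hv : Measurable v)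
    (huC : ∀ p, |u p| ≤ C) (hvC : ∀ p, |v p| ≤ C) (hL : 0 ≤ L) (hM : 0 ≤ M)
    (hf : ∀ p, ‖P.f p (u p) - P.f p (v p)‖ ≤ M * |u p - v p|)
    (hF : ∀ p, Real.sign (u p - v p) * (P.F p (u p) - P.F p (v p)) ≤ L * |u p - v p|)
    {χ : ℝ → ℝ} (hχ : IsTestFunction (Ioo 0 T) χ) :
    0 ≤ ∫ t in Ioo 0 T, coneMass L M R (u - v) t * deriv χ t := by
  have hψ := isTestFunction_mul_coneWeight (E := E) (L := L) (R := R) hχ hM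
  have hwC := abs_sub_apply_le huC hvC
  rw [← integral_abs_mul_deriv_mul_coneWeight (hu.sub hv) hwC hL hM hχ]
  refine (hue.integral_kato_nonneg hve hu hv huC hvC (isOpen_Ioo.prod isOpen_univ) hψ).trans
    (integral_mono (P.integrable_kato_integrand hu hv huC hvC hψ)
      (integrable_abs_mul_deriv_mul_coneWeight (hu.sub hv) hwC hL hM hχ) fun p =>
      sign_mul_kato_integrand_le (hχ.differentiable _) (hχ.nonneg _) (hf p) (hF p))
theorem IsEntropic.ae_eq (hue : IsEntropic P (Ioo 0 T ×ˢ univ) u)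
    (hve : IsEntropic P (Ioo 0 T ×ˢ univ) v) (hu : Measurable u) (hv : Measurable v)
    (huC : ∀ p, |u p| ≤ C) (hvC : ∀ p, |v p| ≤ C) (hL : 0 ≤ L) (hM : 0 ≤ M)
    (hf : ∀ p, ‖P.f p (u p) - P.f p (v p)‖ ≤ M * |u p - v p|)
    (hF : ∀ p, Real.sign (u p - v p) * (P.F p (u p) - P.F p (v p)) ≤ L * |u p - v p|)
    (hinit : ∀ R > 0, ∀ ε > 0, ∃ δ > 0, ∀ᵐ t, t ∈ Ioo 0 δ →
      ∫⁻ x in Metric.ball 0 R, ‖u (t, x) - v (t, x)‖ₑ ≤ ENNReal.ofReal ε) :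
    u =ᵐ[volume.restrict (Ioo 0 T ×ˢ univ)] v := by
  have hwC := abs_sub_apply_le huC hvC
  have hmass (n : ℕ) : ∀ᵐ t, t ∈ Ioo 0 T → coneMass L M (n + 1) (u - v) t = 0 := by
    refine ae_eq_zero_of_integral_mul_deriv_nonneg
      (integrableOn_coneMass (hu.sub hv) hwC hL hM) coneMass_nonneg
      (fun χ hχ => hue.integral_coneMass_mul_deriv_nonneg hve hu hv huC hvC hL hM hf hF hχ)
      fun ε hε => ?_
    obtain ⟨δ, hδ, h⟩ := hinit (n + 1) (by positivity) ε hε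
    refine ⟨δ, hδ, h.mono fun t ht htδ => ?_⟩
    exact coneMass_le (hu.sub hv) hL hM htδ.1.le hε.le (ht htδ)
  have hweight (n : ℕ) : ∀ᵐ p ∂(volume.restrict (Ioo 0 T)).prod (volume : Measure E),
      |(u - v) p| * coneWeight L M (n + 1) p = 0 := by
    have hint := integrable_abs_mul_coneWeight (R := n + 1) (T := T) (hu.sub hv) hwC hL hM
    refine (integral_eq_zero_iff_of_nonneg
      (fun p => mul_nonneg (abs_nonneg _) (coneWeight_nonneg p)) hint).1 ?_
    rw [integral_prod _ hint]
    exact integral_eq_zero_of_ae ((ae_restrict_iff' measurableSet_Ioo).2 (hmass n))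
  rw [Measure.volume_eq_prod, ← Measure.prod_restrict, Measure.restrict_univ]
  filter_upwards [ae_all_iff.2 hweight] with p hp
  obtain ⟨n, hn⟩ := exists_nat_gt (bracket p.2 + M * p.1)
  have := (mul_eq_zero.1 (hp n)).resolve_right (coneWeight_pos (hn.trans (lt_add_one _))).ne'
  exact sub_eq_zero.1 (abs_eq_zero.1 this)

end Uniqueness

section Slab

variable {d : ℕ} {T : ℝ}

theorem slab_eq_restrict_Ioo : slab d T = volume.restrict (Ioo 0 T ×ˢ univ) := by
  rw [slab, Measure.volume_eq_prod, ← Measure.prod_restrict, ← Measure.prod_restrict,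
    Measure.restrict_congr_set Ioo_ae_eq_Icc]

theorem ae_ae_of_ae_slab {p : ℝ × Space d → Prop} (h : ∀ᵐ z ∂slab d T, p z) :
    ∀ᵐ t, t ∈ Ioo 0 T → ∀ᵐ x, p (t, x) := by
  rw [slab_eq_restrict_Ioo, Measure.volume_eq_prod, ← Measure.prod_restrict,
    Measure.restrict_univ] at h
  exact (ae_restrict_iff' measurableSet_Ioo).1 (Measure.ae_ae_of_ae_prod h)

theorem exists_measurable_abs_le_ae_eq {X : Type*} [MeasurableSpace X] {μ : Measure X} {u : X → ℝ}
    (hu : MemLp u ⊤ μ) : ∃ C, ∀ C' ≥ C, ∃ w, Measurable w ∧ (∀ x, |w x| ≤ C') ∧ w =ᵐ[μ] u := by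
  refine ⟨(eLpNorm u ⊤ μ).toReal, fun C hC => ?_⟩
  have hbound : ∀ᵐ x ∂μ, |u x| ≤ C := by
    filter_upwards [ae_le_eLpNormEssSup (f := u)] with x hx
    rw [← eLpNorm_exponent_top] at hx
    rw [← Real.norm_eq_abs, ← toReal_enorm]
    exact (ENNReal.toReal_mono hu.2.ne hx).trans hC
  have hC0 : -C ≤ C := neg_le_self (ENNReal.toReal_nonneg.trans hC)
  obtain ⟨w, hw, huw⟩ := hu.1.aemeasurable
  refine ⟨fun x => max (-C) (min C (w x)), by fun_prop,
    fun x => abs_le.2 ⟨le_max_left _ _, max_le hC0 (min_le_left _ _)⟩, ?_⟩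
  filter_upwards [huw, hbound] with x hx hxC
  rw [← hx, min_eq_right (abs_le.1 hxC).2, max_eq_right (abs_le.1 hxC).1]

end Slab

section Coefficients

variable {d : ℕ} {T : ℝ} {f : ℝ → Space d → ℝ → Space d} {F : ℝ → Space d → ℝ → ℝ}
  {u₀ : Space d → ℝ} {u v : ℝ → Space d → ℝ}

/-- The regularity of the coefficients under which Kružkov's uniqueness argument works: `f`, `∇f`
and `F` are continuous, and on bounded sets of values of the solution, uniformly in `(t,x)`, `f` is
Lipschitz continuous and `F` satisfies a one-sided Lipschitz condition. -/
structure KruzkovCoefficients (T : ℝ) (f : ℝ → Space d → ℝ → Space d)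
    (F : ℝ → Space d → ℝ → ℝ) : Prop where
  cont_f : ContinuousOnSlab T f
  diff_x_f : ∀ t ∈ Icc 0 T, ∀ x u, DifferentiableAt ℝ (fun y => f t y u) x
  cont_gradX_f : ContinuousOnSlab T (gradX f)
  cont_F : ContinuousOnSlab T F
  lipschitz_f : ∀ U > 0, ∃ M ≥ 0, ∀ t ∈ Icc 0 T, ∀ x, ∀ a ∈ Icc (-U) U, ∀ b ∈ Icc (-U) U,
    ‖f t x a - f t x b‖ ≤ M * |a - b|
  one_sided_lipschitz_F : ∀ U > 0, ∃ L ≥ 0, ∀ t ∈ Icc 0 T, ∀ x, ∀ a ∈ Icc (-U) U,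
    ∀ b ∈ Icc (-U) U, b ≤ a → F t x a - F t x b ≤ L * (a - b)

theorem BoundedOnSlab.exists_lipschitz {V : Type*} [NormedAddCommGroup V] [NormedSpace ℝ V]
    {h : ℝ → Space d → ℝ → V} (hbdd : BoundedOnSlab T (derivU h))
    (hdiff : ∀ t ∈ Icc 0 T, ∀ x u, DifferentiableAt ℝ (fun w => h t x w) u) (U : ℝ) (hU : 0 < U) :
    ∃ M ≥ 0, ∀ t ∈ Icc 0 T, ∀ x, ∀ a ∈ Icc (-U) U, ∀ b ∈ Icc (-U) U,
      ‖h t x a - h t x b‖ ≤ M * |a - b| := by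
  obtain ⟨M, hM⟩ := hbdd U hU
  refine ⟨|M|, abs_nonneg M, fun t ht x a ha b hb => ?_⟩
  exact (convex_Icc (-U) U).norm_image_sub_le_of_norm_deriv_le (fun w _ => hdiff t ht x w)
    (fun w hw => (hM t ht x w hw).trans (le_abs_self M)) hb ha

theorem H1.kruzkovCoefficients (h : H1 T f F) (hF : BoundedOnSlab T (derivU F)) :
    KruzkovCoefficients T f F where
  cont_f := h.cont_f
  diff_x_f := h.diff_x_f
  cont_gradX_f := h.cont_gradX_f
  cont_F := h.cont_F
  lipschitz_f := h.bdd_derivU_f.exists_lipschitz h.diff_u_f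
  one_sided_lipschitz_F U hU := by
    obtain ⟨L, hL0, hL⟩ := hF.exists_lipschitz h.diff_u_F U hU
    refine ⟨L, hL0, fun t ht x a ha b hb hba => ?_⟩
    rw [← abs_of_nonneg (sub_nonneg.2 hba)]
    exact (le_abs_self _).trans (hL t ht x a ha b hb)

/-- The extension of a function on `[0,T] × ℝᵈ × ℝ` to all times that is constant in time outside
`[0,T]`. -/
noncomputable def extendTime {V : Type*} (hT : 0 ≤ T) (h : ℝ → Space d → ℝ → V)
    (p : ℝ × Space d) (w : ℝ) : V :=
  h (projIcc 0 T hT p.1) p.2 w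

theorem extendTime_of_mem {V : Type*} (hT : 0 ≤ T) (h : ℝ → Space d → ℝ → V) {p : ℝ × Space d}
    (hp : p.1 ∈ Icc 0 T) (w : ℝ) : extendTime hT h p w = h p.1 p.2 w := by
  rw [extendTime, projIcc_of_mem hT hp]

theorem ContinuousOnSlab.continuous_extendTime {V : Type*} [TopologicalSpace V]
    {h : ℝ → Space d → ℝ → V} (hh : ContinuousOnSlab T h) (hT : 0 ≤ T) :
    Continuous fun z : (ℝ × Space d) × ℝ => extendTime hT h z.1 z.2 :=
  hh.comp_continuous (f := fun z : (ℝ × Space d) × ℝ =>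
      ((projIcc 0 T hT z.1.1 : ℝ), z.1.2, z.2)) (by fun_prop)
    fun z => ⟨(projIcc 0 T hT z.1.1).2, trivial⟩

/-- The balance law on all of `ℝ × ℝᵈ` whose coefficients agree with `f` and `F` on `[0,T]`. -/
noncomputable def KruzkovCoefficients.balanceLaw (h : KruzkovCoefficients T f F) (hT : 0 ≤ T) :
    BalanceLaw (Space d) where
  f := extendTime hT f
  Df := extendTime hT (gradX f)
  F := extendTime hT F
  continuous_f := h.cont_f.continuous_extendTime hT
  continuous_Df := h.cont_gradX_f.continuous_extendTime hT
  continuous_F := h.cont_F.continuous_extendTime hT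
  hasFDerivAt_f t x k := (h.diff_x_f _ (projIcc 0 T hT t).2 x k).hasFDerivAt

theorem divX_eq_traceCLM (t : ℝ) (x : Space d) (k : ℝ) :
    divX f t x k = traceCLM (Space d) (gradX f t x k) := by
  rw [traceCLM_eq_sum (EuclideanSpace.basisFun (Fin d) ℝ).toBasis]
  simp [divX]

theorem KruzkovCoefficients.entropyIntegrand_eq (h : KruzkovCoefficients T f F) (hT : 0 ≤ T)
    (k : ℝ) (φ : ℝ × Space d → ℝ) {p : ℝ × Space d} (hp : p.1 ∈ Icc 0 T) :
    entropyIntegrand f F u k φ p.1 p.2 = Real.sign (u p.1 p.2 - k) *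
      (h.balanceLaw hT).entropyForm p (u p.1 p.2) k (φ p) (fderiv ℝ φ p) := by
  set a := u p.1 p.2
  set y := f p.1 p.2 a - f p.1 p.2 k
  have hsplit : fderiv ℝ φ p (a - k, y) =
      (a - k) * fderiv ℝ φ p (1, 0) + fderiv ℝ φ p (0, y) := by
    rw [← smul_eq_mul, ← map_smul, ← map_add]
    simp
  simp only [entropyIntegrand, BalanceLaw.entropyForm, BalanceLaw.divf, balanceLaw,
    extendTime_of_mem hT _ hp, ← divX_eq_traceCLM]
  rw [hsplit, ← sign_mul_self_eq_abs]
  ring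

theorem IsWeakEntropySolution.isEntropic (hu : IsWeakEntropySolution T f F u₀ u)
    (h : KruzkovCoefficients T f F) (hT : 0 ≤ T) {w : ℝ × Space d → ℝ}
    (hw : w =ᵐ[slab d T] fun p => u p.1 p.2) :
    IsEntropic (h.balanceLaw hT) (Ioo 0 T ×ˢ univ) w := by
  intro k φ hφ
  have hzero (p) (hp : p ∉ Ioo 0 T ×ˢ univ) : Real.sign (w p - k) *
      (h.balanceLaw hT).entropyForm p (w p) k (φ p) (fderiv ℝ φ p) = 0 := by
    have hpφ := fun hp' => hp (hφ.tsupport_subset hp')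
    simp [BalanceLaw.entropyForm, image_eq_zero_of_notMem_tsupport hpφ,
      fderiv_of_notMem_tsupport ℝ hpφ]
  rw [← setIntegral_eq_integral_of_forall_compl_eq_zero hzero]
  refine (hu.entropy k φ hφ.contDiff hφ.hasCompactSupport hφ.tsupport_subset hφ.nonneg).trans_eq ?_
  rw [slab_eq_restrict_Ioo] at hw ⊢
  refine integral_congr_ae ?_
  filter_upwards [hw, ae_restrict_mem (measurableSet_Ioo.prod .univ)] with p hwp hp
  rw [hwp, h.entropyIntegrand_eq hT k φ (Ioo_subset_Icc_self hp.1)]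

end Coefficients

section Traces

variable {d : ℕ} {T r : ℝ} {f : ℝ → Space d → ℝ → Space d} {F : ℝ → Space d → ℝ → ℝ}
  {u₀ : Space d → ℝ} {u v : ℝ → Space d → ℝ}

theorem lintegral_enorm_sub_le {X : Type*} [MeasurableSpace X] {μ : Measure X} {a b c : X → ℝ}
    (ha : AEStronglyMeasurable a μ) (hc : AEStronglyMeasurable c μ) :
    ∫⁻ x, ‖a x - b x‖ₑ ∂μ ≤ ∫⁻ x, ‖a x - c x‖ₑ ∂μ + ∫⁻ x, ‖b x - c x‖ₑ ∂μ := by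
  simpa only [edist_eq_enorm_sub] using lintegral_edist_triangle (g := b) ha hc

theorem IsWeakEntropySolution.exists_lintegral_sub_le (hu : IsWeakEntropySolution T f F u₀ u)
    (hv : IsWeakEntropySolution T f F u₀ v) (hT : 0 < T) (hu₀ : AEStronglyMeasurable u₀)
    (hr : 0 < r) {ε : ℝ≥0∞} (hε : 0 < ε) :
    ∃ δ ∈ Ioc 0 T, ∀ᵐ t, t ∈ Ioo 0 δ → ∫⁻ x in Metric.ball 0 r, ‖u t x - v t x‖ₑ ≤ ε := by
  obtain ⟨N, -, hN, hu_meas, hu_lim⟩ := hu.initial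
  obtain ⟨N', -, hN', -, hv_lim⟩ := hv.initial
  have hlim := ((hu_lim r hr).mono_left (nhdsWithin_mono 0
    (sdiff_subset_sdiff_right (subset_union_left (t := N'))))).add
    ((hv_lim r hr).mono_left (nhdsWithin_mono 0
    (sdiff_subset_sdiff_right (subset_union_right (s := N)))))
  rw [add_zero] at hlim
  obtain ⟨δ, hδ, hδε⟩ := Metric.eventually_nhds_iff.1
    (eventually_nhdsWithin_iff.1 (hlim.eventually_le_const hε))
  refine ⟨min δ T, ⟨lt_min hδ hT, min_le_right δ T⟩, ?_⟩
  filter_upwards [measure_eq_zero_iff_ae_notMem.1 (measure_union_null hN hN')] with t htN ht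
  have htT : t ∈ Ioc 0 T := ⟨ht.1, ht.2.le.trans (min_le_right δ T)⟩
  refine (lintegral_enorm_sub_le (hu_meas t ⟨Ioc_subset_Icc_self htT,
    fun h => htN (.inl h)⟩).restrict hu₀.restrict).trans (hδε ?_ ⟨htT, htN⟩)
  rw [Real.dist_eq, sub_zero, abs_of_pos ht.1]
  exact ht.2.trans_le (min_le_left δ T)

theorem frequently_nhdsGT_of_ae {p : ℝ → Prop} (hp : ∀ᵐ s, p s) (t : ℝ) : ∃ᶠ s in 𝓝[>] t, p s := by
  intro h
  obtain ⟨b, htb, hb⟩ := mem_nhdsGT_iff_exists_Ioo_subset.1 h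
  obtain ⟨s, hs, hsp⟩ :=
    (Measure.dense_of_ae hp).exists_mem_open isOpen_Ioo (nonempty_Ioo.2 htb)
  exact hb hsp hs

theorem RightContinuousL1loc.lintegral_sub_eq_zero (hu : RightContinuousL1loc T u)
    (hv : RightContinuousL1loc T v) (huv : ∀ᵐ p ∂slab d T, v p.1 p.2 = u p.1 p.2) {t : ℝ}
    (ht : t ∈ Ico 0 T) (hr : 0 < r) : ∫⁻ x in Metric.ball 0 r, ‖v t x - u t x‖ₑ = 0 := by
  have htI := Ico_subset_Icc_self ht
  have hlim := (hv.2 t htI r hr).add (hu.2 t htI r hr)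
  rw [add_zero, nhdsWithin_Ioc_eq_nhdsGT ht.2] at hlim
  have hfreq := (frequently_nhdsGT_of_ae (ae_ae_of_ae_slab huv) t).and_eventually
    (Ioo_mem_nhdsGT ht.2)
  refine le_antisymm (ge_of_tendsto_of_frequently hlim (hfreq.mono fun s hs => ?_)) zero_le
  have hs0 : s ∈ Ioo 0 T := ⟨ht.1.trans_lt hs.2.1, hs.2.2⟩
  have hsuv : ∫⁻ x in Metric.ball 0 r, ‖u s x - u t x‖ₑ =
      ∫⁻ x in Metric.ball 0 r, ‖u t x - v s x‖ₑ := by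
    refine lintegral_congr_ae (ae_restrict_of_ae ?_)
    filter_upwards [hs.1 hs0] with x hx
    rw [hx, enorm_sub_rev]
  simp_rw [hsuv, enorm_sub_rev (v s _)]
  exact lintegral_enorm_sub_le (hv.1 t htI).aestronglyMeasurable.restrict
    (hv.1 s (Ioo_subset_Icc_self hs0)).aestronglyMeasurable.restrict

theorem RightContinuousL1loc.ae_eq (hu : RightContinuousL1loc T u)
    (hv : RightContinuousL1loc T v) (huv : ∀ᵐ p ∂slab d T, v p.1 p.2 = u p.1 p.2) {t : ℝ}
    (ht : t ∈ Ico 0 T) : v t =ᵐ[volume] u t := by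
  have htI := Ico_subset_Icc_self ht
  rw [← Measure.restrict_univ (μ := volume), ← Metric.iUnion_ball_nat_succ 0,
    ae_eq_restrict_iUnion_iff]
  intro n
  have hmeas := ((hv.1 t htI).aestronglyMeasurable.sub
    (hu.1 t htI).aestronglyMeasurable).enorm.restrict (s := Metric.ball 0 (n + 1))
  filter_upwards [(lintegral_eq_zero_iff' hmeas).1
    (hu.lintegral_sub_eq_zero hv huv ht (by positivity))] with x hx
  exact sub_eq_zero.1 (enorm_eq_zero.1 hx)

theorem KruzkovCoefficients.exists_sign_mul_le (h : KruzkovCoefficients T f F) (hT : 0 ≤ T)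
    {U : ℝ} (hU : 0 < U) : ∃ L ≥ 0, ∀ p a b, |a| ≤ U → |b| ≤ U →
      Real.sign (a - b) * ((h.balanceLaw hT).F p a - (h.balanceLaw hT).F p b) ≤ L * |a - b| := by
  obtain ⟨L, hL0, hL⟩ := h.one_sided_lipschitz_F U hU
  refine ⟨L, hL0, fun p a b ha hb => ?_⟩
  have ht := (projIcc 0 T hT p.1).2
  rcases lt_trichotomy a b with hab | rfl | hab
  · have := hL _ ht p.2 b (abs_le.1 hb) a (abs_le.1 ha) hab.le
    rw [Real.sign_of_neg (sub_neg.2 hab), abs_of_neg (sub_neg.2 hab), neg_one_mul, neg_sub, neg_sub]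
    exact this
  · simp
  · have := hL _ ht p.2 a (abs_le.1 ha) b (abs_le.1 hb) hab.le
    rw [Real.sign_of_pos (sub_pos.2 hab), abs_of_pos (sub_pos.2 hab), one_mul]
    exact this

theorem KruzkovCoefficients.ae_eq (h : KruzkovCoefficients T f F) (hT : 0 < T)
    (hu₀ : AEStronglyMeasurable u₀) (hu : IsWeakEntropySolution T f F u₀ u)
    (hv : IsWeakEntropySolution T f F u₀ v) : ∀ᵐ p ∂slab d T, v p.1 p.2 = u p.1 p.2 := by
  obtain ⟨Cu, hCu⟩ := exists_measurable_abs_le_ae_eq hu.memLp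
  obtain ⟨Cv, hCv⟩ := exists_measurable_abs_le_ae_eq hv.memLp
  set C := max 1 (max Cu Cv)
  have hC : 0 < C := by positivity
  obtain ⟨u', hu', hu'C, huu'⟩ := hCu C (by simp [C])
  obtain ⟨v', hv', hv'C, hvv'⟩ := hCv C (by simp [C])
  obtain ⟨M, hM0, hM⟩ := h.lipschitz_f C hC
  obtain ⟨L, hL0, hL⟩ := h.exists_sign_mul_le hT.le hC
  have key : u' =ᵐ[slab d T] v' := by
    rw [slab_eq_restrict_Ioo]
    refine (hu.isEntropic h hT.le huu').ae_eq (hv.isEntropic h hT.le hvv') hu' hv' hu'C hv'C hL0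
      hM0 (fun p => hM _ (projIcc 0 T hT.le p.1).2 p.2 _ (abs_le.1 (hu'C p)) _
        (abs_le.1 (hv'C p))) (fun p => hL p _ _ (hu'C p) (hv'C p)) fun R hR ε hε => ?_
    obtain ⟨δ, hδ, hδε⟩ := hu.exists_lintegral_sub_le hv hT hu₀ hR (ENNReal.ofReal_pos.2 hε)
    refine ⟨δ, hδ.1, ?_⟩
    filter_upwards [hδε, ae_ae_of_ae_slab huu', ae_ae_of_ae_slab hvv'] with t ht htu htv htδ
    have htT : t ∈ Ioo 0 T := ⟨htδ.1, htδ.2.trans_le hδ.2⟩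
    refine (lintegral_congr_ae (ae_restrict_of_ae ?_)).trans_le (ht htδ)
    filter_upwards [htu htT, htv htT] with x hux hvx
    rw [hux, hvx]
  filter_upwards [key, huu', hvv'] with p hp hpu hpv
  rw [← hpu, ← hpv, hp]

end Traces

end ConservationLaw

theorem corollaryB4_general {d : ℕ} {T : ℝ} (hT : 0 < T)
    {f : ℝ → ConservationLaw.Space d → ℝ → ConservationLaw.Space d}
    {F : ℝ → ConservationLaw.Space d → ℝ → ℝ}
    {u₀ : ConservationLaw.Space d → ℝ} {u : ℝ → ConservationLaw.Space d → ℝ}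
    (h : ConservationLaw.KruzkovCoefficients T f F) (hu₀ : AEStronglyMeasurable u₀ volume)
    (hu : ConservationLaw.IsWeakEntropySolution T f F u₀ u)
    (v : ℝ → ConservationLaw.Space d → ℝ)
    (hv : ConservationLaw.IsWeakEntropySolution T f F u₀ v) :
    (∀ᵐ p ∂(ConservationLaw.slab d T), v p.1 p.2 = u p.1 p.2) ∧
      (ConservationLaw.RightContinuousL1loc T u → ConservationLaw.RightContinuousL1loc T v →
        ∀ t ∈ Ico (0 : ℝ) T, v t =ᵐ[volume] u t) :=
  have huv := h.ae_eq hT hu₀ hu hv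
  ⟨huv, fun hur hvr _ ht => hur.ae_eq hvr huv ht⟩

theorem corollaryB4 {d : ℕ} {T : ℝ} (hT : 0 < T)
    -- the problem, its initial datum, and the given weak entropy solution
    (f : ℝ → ConservationLaw.Space d → ℝ → ConservationLaw.Space d)
    (F : ℝ → ConservationLaw.Space d → ℝ → ℝ)
    (u₀ : ConservationLaw.Space d → ℝ)
    (hu₀ : MemLp u₀ ⊤ volume)
    (hH1 : ConservationLaw.H1 T f F)
    (hH2 : ConservationLaw.H2Star T f F)
    (u : ℝ → ConservationLaw.Space d → ℝ)
    (hu : ConservationLaw.IsWeakEntropySolution T f F u₀ u)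
    -- the approximating problems, indexed by `ε > 0`, and their solutions
    (fε : ℝ → ℝ → ConservationLaw.Space d → ℝ → ConservationLaw.Space d)
    (Fε : ℝ → ℝ → ConservationLaw.Space d → ℝ → ℝ)
    (u₀ε : ℝ → ConservationLaw.Space d → ℝ)
    (uε : ℝ → ℝ → ConservationLaw.Space d → ℝ)
    (hu₀ε : ∀ ε : ℝ, 0 < ε → MemLp (u₀ε ε) ⊤ volume)
    (hH1ε : ∀ ε : ℝ, 0 < ε → ConservationLaw.H1 T (fε ε) (Fε ε))
    (hH2ε : ∀ ε : ℝ, 0 < ε → ConservationLaw.H2 T (fε ε) (Fε ε))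
    (huε : ∀ ε : ℝ, 0 < ε →
      ConservationLaw.IsWeakEntropySolution T (fε ε) (Fε ε) (u₀ε ε) (uε ε))
    (hbdd : ∃ C : ℝ, ∀ ε : ℝ, 0 < ε →
      ∀ᵐ p ∂(ConservationLaw.slab d T), |uε ε p.1 p.2| ≤ C)
    (hlim : ConservationLaw.TendstoL1L1loc T uε u)
    -- the data agree on larger and larger balls
    (hagree : ∀ R : ℝ, 0 < R → ∃ ε : ℝ, 0 < ε ∧
      (∀ t ∈ Icc (0 : ℝ) T, ∀ x ∈ Metric.ball (0 : ConservationLaw.Space d) R, ∀ w : ℝ,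
        fε ε t x w = f t x w ∧ Fε ε t x w = F t x w) ∧
      ∀ᵐ x ∂(volume.restrict (Metric.ball (0 : ConservationLaw.Space d) R)), u₀ε ε x = u₀ x) :
    ConservationLaw.IsWeakEntropySolution T f F u₀ u ∧
    ∀ v : ℝ → ConservationLaw.Space d → ℝ,
      ConservationLaw.IsWeakEntropySolution T f F u₀ v →
        (∀ᵐ p ∂(ConservationLaw.slab d T), v p.1 p.2 = u p.1 p.2) ∧
        (ConservationLaw.RightContinuousL1loc T u → ConservationLaw.RightContinuousL1loc T v →
          ∀ t ∈ Ico (0 : ℝ) T, v t =ᵐ[volume] u t) :=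
  ⟨hu, corollaryB4_general hT (hH1.kruzkovCoefficients hH2.bdd_derivU_F) hu₀.1 hu⟩
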